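/- Let $\overline{\triangle}=\{(x,y)\in\mathbb R^2 : 1\ge x\ge y\ge 0\}$, equipped with its Borel $\sigma$-algebra and with two-dimensional Lebesgue measure $m$. Let $\Gamma_0=\{(x,y)\in\mathbb R^2 : 1\ge x\ge y>1-x\}$ and $\Gamma_1=\overline{\triangle}\setminus\Gamma_0$, and let the slow triangle map $S:\overline{\triangle}\to\overline{\triangle}$ be $$S(x,y)=\begin{cases}\left(\dfrac yx,\ \dfrac{1-x}{x}\right) & \text{if }(x,y)\in\Gamma_0,\\[2mm] \left(\dfrac{x}{1-y},\ \dfrac{y}{1-y}\right) & \text{if }(x,y)\in\Gamma_1.\end{cases}$$ Let $\mu$ be the measure on $\overline{\triangle}$ with density $h(x,y)=\dfrac{1}{xy}$ with respect to $m$. Then: 1. the system $(\overline{\triangle},\mu,S)$ is conservative; 2. $\mu$ is $S$-invariant, ergodic and absolutely continuous with respect to $m$, and it is the unique such measure up to multiplicative constants: if $\nu$ is any $S$-invariant ergodic measure on $\overline{\triangle}$ with $\nu\ll m$, then $\nu=c\,\mu$ for some constant $c\in[0,\infty]$, and $c<\infty$ whenever $\nu$ is $\sigma$-finite; 3. $\mu$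 is $\sigma$-finite and $\mu(\overline{\triangle})=+\infty$. -/

import Mathlib

open MeasureTheory Set
open scoped ENNReal

/-- The closed triangle `{(x, y) : 1 ≥ x ≥ y ≥ 0}` in the plane. As a type it carries the
subspace σ-algebra. -/
def closedTriangle : Set (ℝ × ℝ) := {p | 0 ≤ p.2 ∧ p.2 ≤ p.1 ∧ p.1 ≤ 1}

/-- Planar Lebesgue measure on the closed triangle. -/
noncomputable def triangleLebesgue : Measure closedTriangle :=
  Measure.comap Subtype.val (volume : Measure (ℝ × ℝ))

/-- `Γ₀ = {(x, y) : 1 ≥ x ≥ y > 1 - x}`. -/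
def Gamma0 : Set (ℝ × ℝ) := {p | 1 - p.1 < p.2 ∧ p.2 ≤ p.1 ∧ p.1 ≤ 1}

open Classical in
/-- The two-branch formula of the slow triangle map. On the closed triangle, the second branch
is used exactly on `Γ₁ = closedTriangle \ Γ₀`. -/
noncomputable def slowTriangleFun (p : ℝ × ℝ) : ℝ × ℝ :=
  if p ∈ Gamma0 then (p.2 / p.1, (1 - p.1) / p.1)
  else (p.1 / (1 - p.2), p.2 / (1 - p.2))

/-- The formula maps the closed triangle to itself. -/
theorem slowTriangleFun_mapsTo : MapsTo slowTriangleFun closedTriangle closedTriangle := by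
  rintro ⟨x, y⟩ ⟨h0, h1, h2⟩
  simp only at h0 h1 h2
  unfold slowTriangleFun
  split_ifs with h
  · obtain ⟨h3, -, -⟩ := h
    simp only at h3
    have hx : 0 < x := by linarith
    refine ⟨div_nonneg (by linarith) hx.le, ?_, ?_⟩
    · exact div_le_div_of_nonneg_right (by linarith) hx.le
    · exact (div_le_one hx).2 h1
  · have h3 : y ≤ 1 - x := by
      by_contra h'
      exact h ⟨not_le.1 h', h1, h2⟩
    have hy : 0 < 1 - y := by linarith
    refine ⟨div_nonneg h0 hy.le, ?_, ?_⟩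
    · exact div_le_div_of_nonneg_right h1 hy.le
    · exact (div_le_one hy).2 (by simp only; linarith)

/-- The slow triangle map `S`, a self-map of the closed triangle. -/
noncomputable def slowTriangleMap : closedTriangle → closedTriangle :=
  slowTriangleFun_mapsTo.restrict

/-- The measure on the closed triangle with density `1 / (x y)` with respect to Lebesgue measure
(the value of the density on the Lebesgue-null segment `y = 0` is irrelevant). -/
noncomputable def slowTriangleMeasure : Measure closedTriangle :=
  triangleLebesgue.withDensity
    fun p => ENNReal.ofReal (1 / ((p : ℝ × ℝ).1 * (p : ℝ × ℝ).2))

/-!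
The slow triangle map `S` has the two inverse branches `(a, b) ↦ (1, a) / (1 + b)` and
`(a, b) ↦ (a, b) / (1 + b)`, both projective with Jacobian `(1 + b)⁻³`. Changing variables along the
branches (`setLIntegral_zeroCell_inter_preimage`, `setLIntegral_compl_zeroCell_inter_preimage`)
shows that the density `1 / (xy)` is invariant.

**Weights.** A composition `φ` of inverse branches is projective, and its Jacobian is the inverse
cube of an affine function with values `α ≤ β ≤ γ` at the vertices of the triangle. Composing with
one more branch replaces the weights by `(β, γ, α + γ)` or `(α, β, α + γ)`, and the image of the
triangle has measure proportional to `1 / (αβγ)` (`weightedMass_univ`). Distortion is bounded on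
balanced weights, those with `γ ≤ 8α`. The averaging lemma `le_of_le_on_balanced` says that an
upper bound for the relative mass of a set on balanced weights extends to all weights, because a
definite proportion of the mass reaches balanced weights: adding `α` to `γ` until `γ` has doubled
uses up half of the mass, and two such rounds suffice.

**Recurrence.** For balanced weights a definite proportion of the points visit `Γ₀` three times in
a row. The averaging lemma, applied iteratively to the set of points that never do so, shows that
this set is null, so that almost every orbit visits the triple cell infinitely often
(`ae_frequently_mem_tripleCell`). The triple cell stays away from `y = 0` and thus has finite
`μ`-measure, hence the system is conservative (`conservative_of_ae_frequently_mem`).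

**Ergodicity.** Let `B` be invariant with a complement of positive measure. By bounded distortion
and the averaging lemma, there is a `κ < 1` such that `B` occupies at most the proportion `κ` of
each cylinder. Each triple of consecutive visits to `Γ₀` shrinks the diameter of the cylinder by
the factor `2 / 3` (`WeightedTriangle.SidesLE.zero_zero_zero`), so cylinders exhaust every open set
up to a null set, and `m (B ∩ U) ≤ κ * m U` for all open `U`. Outer regularity gives `m B = 0`.

**Uniqueness.** This holds for every conservative ergodic σ-finite system (`exists_eq_smul`). If
`ν = f μ` is invariant, the truncation `min f c • μ` is sub-invariant, hence invariant by
conservativity; so the sublevel sets of `f` are invariant up to null sets, and `f` is constant by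
ergodicity. An invariant `ν` that is not σ-finite is infinite on all sets of positive measure.

**Infinite mass.** The slabs `{x ≥ 1/2, y ≤ 1/n}` have measure at least `1/2` and decrease to a
null set.
-/

/-! ### Projective maps of the plane -/

/-- The affine form `p ↦ N i 0 + N i 1 * p.1 + N i 2 * p.2`: the `i`-th coordinate of `N` applied
to the homogeneous vector `(1, p.1, p.2)`. -/
def affineForm (N : Matrix (Fin 3) (Fin 3) ℝ) (i : Fin 3) (p : ℝ × ℝ) : ℝ :=
  N i 0 + N i 1 * p.1 + N i 2 * p.2

/-- The projective map of the plane with matrix `N` in the homogeneous coordinates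
`(1, p.1, p.2)`. -/
noncomputable def projectiveMap (N : Matrix (Fin 3) (Fin 3) ℝ) (p : ℝ × ℝ) : ℝ × ℝ :=
  (affineForm N 1 p / affineForm N 0 p, affineForm N 2 p / affineForm N 0 p)

lemma affineForm_eq_mulVec (N : Matrix (Fin 3) (Fin 3) ℝ) (i : Fin 3) (p : ℝ × ℝ) :
    affineForm N i p = N.mulVec ![1, p.1, p.2] i := by
  simp [affineForm, Matrix.mulVec, dotProduct, Fin.sum_univ_three]

lemma injOn_projectiveMap {N : Matrix (Fin 3) (Fin 3) ℝ} (hN : N.det ≠ 0) {E : Set (ℝ × ℝ)}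
    (hE : ∀ p ∈ E, 0 < affineForm N 0 p) : InjOn (projectiveMap N) E := by
  intro p hp q hq h
  have hp0 := (hE p hp).ne'
  have hq0 := (hE q hq).ne'
  simp only [projectiveMap, Prod.mk.injEq] at h
  obtain ⟨h1, h2⟩ := h
  rw [div_eq_div_iff hp0 hq0] at h1 h2
  have key : N.mulVec (affineForm N 0 q • ![1, p.1, p.2]) =
      N.mulVec (affineForm N 0 p • ![1, q.1, q.2]) := by
    rw [Matrix.mulVec_smul, Matrix.mulVec_smul]
    funext i
    simp only [Pi.smul_apply, smul_eq_mul, ← affineForm_eq_mulVec]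
    fin_cases i
    · exact mul_comm _ _
    · exact (mul_comm _ _).trans (h1.trans (mul_comm _ _))
    · exact (mul_comm _ _).trans (h2.trans (mul_comm _ _))
  have inj := Matrix.mulVec_injective_of_isUnit
    ((Matrix.isUnit_iff_isUnit_det N).2 (isUnit_iff_ne_zero.2 hN)) key
  have e0 := congrFun inj 0
  have e1 := congrFun inj 1
  have e2 := congrFun inj 2
  simp only [Pi.smul_apply, smul_eq_mul, Matrix.cons_val_zero, mul_one, Matrix.cons_val_one,
    Matrix.cons_val] at e0 e1 e2
  rw [e0] at e1 e2
  exact Prod.ext (mul_left_cancel₀ hp0 e1) (mul_left_cancel₀ hp0 e2)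

/-- The Jacobian determinant of a projective map is the determinant of its matrix divided by the
cube of the denominator. -/
lemma lintegral_image_projectiveMap {N : Matrix (Fin 3) (Fin 3) ℝ} (hN : N.det ≠ 0)
    {E : Set (ℝ × ℝ)} (hEm : MeasurableSet E) (hE : ∀ p ∈ E, 0 < affineForm N 0 p)
    (g : ℝ × ℝ → ℝ≥0∞) :
    ∫⁻ x in projectiveMap N '' E, g x =
      ∫⁻ p in E, ENNReal.ofReal (|N.det| / affineForm N 0 p ^ 3) * g (projectiveMap N p) := by
  have hd : ∀ i (p : ℝ × ℝ), HasFDerivAt (affineForm N i)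
      (N i 1 • ContinuousLinearMap.fst ℝ ℝ ℝ + N i 2 • ContinuousLinearMap.snd ℝ ℝ ℝ) p := by
    intro i p
    unfold affineForm
    have h1 : HasFDerivAt (fun p : ℝ × ℝ => N i 1 * p.1)
      (N i 1 • ContinuousLinearMap.fst ℝ ℝ ℝ) p := hasFDerivAt_fst.const_mul _
    have h2 : HasFDerivAt (fun p : ℝ × ℝ => N i 2 * p.2)
      (N i 2 • ContinuousLinearMap.snd ℝ ℝ ℝ) p := hasFDerivAt_snd.const_mul _
    exact (h1.const_add _).add h2
  set D : ℝ × ℝ → (ℝ × ℝ →L[ℝ] ℝ × ℝ) := fun p =>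
    (Matrix.toLin (.finTwoProd ℝ) (.finTwoProd ℝ)
      !![(N 1 1 * affineForm N 0 p - affineForm N 1 p * N 0 1) / affineForm N 0 p ^ 2,
         (N 1 2 * affineForm N 0 p - affineForm N 1 p * N 0 2) / affineForm N 0 p ^ 2;
         (N 2 1 * affineForm N 0 p - affineForm N 2 p * N 0 1) / affineForm N 0 p ^ 2,
         (N 2 2 * affineForm N 0 p - affineForm N 2 p * N 0 2) / affineForm N 0 p ^ 2]
      ).toContinuousLinearMap with hD
  have hder : ∀ p ∈ E, HasFDerivWithinAt (projectiveMap N) (D p) E p := by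
    intro p hp
    have h0 := (hE p hp).ne'
    apply HasFDerivAt.hasFDerivWithinAt
    rw [hD]
    simp only [Matrix.toLin_finTwoProd_toContinuousLinearMap]
    have e := fun i => (hd i p).mul ((hasDerivAt_inv h0).comp_hasFDerivAt p (hd 0 p))
    have hfun : projectiveMap N = fun p =>
        ((affineForm N 1 * (Inv.inv ∘ affineForm N 0)) p,
          (affineForm N 2 * (Inv.inv ∘ affineForm N 0)) p) := by
      funext q
      simp [projectiveMap, div_eq_mul_inv]
    rw [hfun]
    refine ((e 1).prodMk (e 2)).congr_fderiv ?_
    ext <;> simp <;> field_simp <;> ring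
  have hdet : ∀ p ∈ E, (D p).det = N.det / affineForm N 0 p ^ 3 := by
    intro p hp
    have h0 := (hE p hp).ne'
    rw [hD]
    simp only [ContinuousLinearMap.det, LinearMap.coe_toContinuousLinearMap, LinearMap.det_toLin,
      Matrix.det_fin_two_of, Matrix.det_fin_three]
    field_simp
    simp only [affineForm]
    ring
  rw [lintegral_image_eq_lintegral_abs_det_fderiv_mul volume hEm hder (injOn_projectiveMap hN hE)]
  refine setLIntegral_congr_fun hEm fun p hp => ?_
  rw [hdet p hp, abs_div, abs_of_pos (pow_pos (hE p hp) 3)]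

/-! ### The two inverse branches -/

lemma measurableSet_closedTriangle : MeasurableSet closedTriangle :=
  (measurableSet_le measurable_const measurable_snd).inter
    ((measurableSet_le measurable_snd measurable_fst).inter
      (measurableSet_le measurable_fst measurable_const))

lemma measurableSet_Gamma0 : MeasurableSet Gamma0 :=
  (measurableSet_lt (by fun_prop) measurable_snd).inter
    ((measurableSet_le measurable_snd measurable_fst).inter
      (measurableSet_le measurable_fst measurable_const))

/-- The cell `Γ₀` as a subset of the triangle; its complement is `Γ₁`. -/
def zeroCell : Set closedTriangle := Subtype.val ⁻¹' Gamma0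

lemma measurableSet_zeroCell : MeasurableSet zeroCell :=
  measurable_subtype_coe measurableSet_Gamma0

lemma mem_zeroCell {p : closedTriangle} : p ∈ zeroCell ↔ 1 - p.1.1 < p.1.2 :=
  ⟨fun h => h.1, fun h => ⟨h, p.2.2.1, p.2.2.2⟩⟩

lemma slowTriangleMap_of_mem {p : closedTriangle} (h : p ∈ zeroCell) :
    (slowTriangleMap p : ℝ × ℝ) = (p.1.2 / p.1.1, (1 - p.1.1) / p.1.1) :=
  if_pos (show p.1 ∈ Gamma0 from h)

lemma slowTriangleMap_of_notMem {p : closedTriangle} (h : p ∉ zeroCell) :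
    (slowTriangleMap p : ℝ × ℝ) = (p.1.1 / (1 - p.1.2), p.1.2 / (1 - p.1.2)) :=
  if_neg (show p.1 ∉ Gamma0 from h)

lemma measurable_slowTriangleMap : Measurable slowTriangleMap := by
  apply Measurable.subtype_mk
  apply Measurable.ite (p := fun p : closedTriangle => p.1 ∈ Gamma0) measurableSet_zeroCell
  · fun_prop
  · fun_prop

/-- Homogeneous matrix of the inverse branch `(a, b) ↦ (1 / (1 + b), a / (1 + b))` of the slow
triangle map onto `Γ₀`. -/
def zeroMatrix : Matrix (Fin 3) (Fin 3) ℝ := !![1, 0, 1; 1, 0, 0; 0, 1, 0]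

/-- Homogeneous matrix of the inverse branch `(a, b) ↦ (a / (1 + b), b / (1 + b))` of the slow
triangle map onto `Γ₁`. -/
def oneMatrix : Matrix (Fin 3) (Fin 3) ℝ := !![1, 0, 1; 0, 1, 0; 0, 0, 1]

lemma det_zeroMatrix : zeroMatrix.det = 1 := by simp [zeroMatrix, Matrix.det_fin_three]

lemma det_oneMatrix : oneMatrix.det = 1 := by simp [oneMatrix, Matrix.det_fin_three]

lemma affineForm_zeroMatrix (p : ℝ × ℝ) : affineForm zeroMatrix 0 p = 1 + p.2 := by
  simp [zeroMatrix, affineForm]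

lemma affineForm_oneMatrix (p : ℝ × ℝ) : affineForm oneMatrix 0 p = 1 + p.2 := by
  simp [oneMatrix, affineForm]

lemma projectiveMap_zeroMatrix (p : ℝ × ℝ) :
    projectiveMap zeroMatrix p = (1 / (1 + p.2), p.1 / (1 + p.2)) := by
  simp [zeroMatrix, projectiveMap, affineForm]

lemma projectiveMap_oneMatrix (p : ℝ × ℝ) :
    projectiveMap oneMatrix p = (p.1 / (1 + p.2), p.2 / (1 + p.2)) := by
  simp [oneMatrix, projectiveMap, affineForm]

lemma image_zeroCell_inter_preimage (E : Set closedTriangle) :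
    Subtype.val '' (zeroCell ∩ slowTriangleMap ⁻¹' E) =
      projectiveMap zeroMatrix '' (Subtype.val '' E ∩ {p | p.2 < p.1}) := by
  ext q
  constructor
  · rintro ⟨p, ⟨hp, hpE⟩, rfl⟩
    have h1 := mem_zeroCell.1 hp
    have hS := slowTriangleMap_of_mem hp
    have hx : 0 < p.1.1 := by have := p.2.2.1; linarith
    refine ⟨slowTriangleMap p, ⟨⟨_, hpE, rfl⟩, ?_⟩, ?_⟩
    · rw [hS, mem_ofPred_eq]
      exact div_lt_div_of_pos_right h1 hx
    · rw [hS, projectiveMap_zeroMatrix]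
      ext
      · simp only; field_simp; ring
      · simp only; field_simp; ring
  · rintro ⟨_, ⟨⟨p, hpE, rfl⟩, hlt⟩, rfl⟩
    rw [mem_ofPred_eq] at hlt
    obtain ⟨h0, h1, h2⟩ := p.2
    have hd : 0 < 1 + p.1.2 := by linarith
    rw [projectiveMap_zeroMatrix]
    have hq : ((1 / (1 + p.1.2), p.1.1 / (1 + p.1.2)) : ℝ × ℝ) ∈ closedTriangle :=
      ⟨div_nonneg (h0.trans h1) hd.le, div_le_div_of_nonneg_right h2 hd.le,
        (div_le_one hd).2 (by simpa using h0)⟩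
    have hc : (⟨_, hq⟩ : closedTriangle) ∈ zeroCell := by
      rw [mem_zeroCell]
      simp only
      rw [lt_div_iff₀ hd, sub_mul, div_mul_cancel₀ _ hd.ne']
      linarith
    refine ⟨⟨_, hq⟩, ⟨hc, ?_⟩, rfl⟩
    have : slowTriangleMap ⟨_, hq⟩ = p := by
      apply Subtype.ext
      rw [slowTriangleMap_of_mem hc]
      ext
      · simp only; field_simp
      · simp only; field_simp; ring
    rwa [mem_preimage, this]

lemma image_compl_zeroCell_inter_preimage (E : Set closedTriangle) :
    Subtype.val '' (zeroCellᶜ ∩ slowTriangleMap ⁻¹' E) =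
      projectiveMap oneMatrix '' (Subtype.val '' E) := by
  ext q
  constructor
  · rintro ⟨p, ⟨hp, hpE⟩, rfl⟩
    have hS := slowTriangleMap_of_notMem hp
    have h1 := mt mem_zeroCell.2 hp
    rw [not_lt] at h1
    obtain ⟨h0, h3, h2⟩ := p.2
    have hy : 0 < 1 - p.1.2 := by linarith
    refine ⟨slowTriangleMap p, ⟨_, hpE, rfl⟩, ?_⟩
    rw [hS, projectiveMap_oneMatrix]
    ext
    · simp only; field_simp; ring
    · simp only; field_simp; ring
  · rintro ⟨_, ⟨p, hpE, rfl⟩, rfl⟩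
    obtain ⟨h0, h1, h2⟩ := p.2
    have hd : 0 < 1 + p.1.2 := by linarith
    rw [projectiveMap_oneMatrix]
    have hq : ((p.1.1 / (1 + p.1.2), p.1.2 / (1 + p.1.2)) : ℝ × ℝ) ∈ closedTriangle :=
      ⟨div_nonneg h0 hd.le, div_le_div_of_nonneg_right h1 hd.le,
        (div_le_one hd).2 (by linarith)⟩
    have hc : (⟨_, hq⟩ : closedTriangle) ∉ zeroCell := by
      rw [mem_zeroCell]
      simp only
      rw [lt_div_iff₀ hd, sub_mul, div_mul_cancel₀ _ hd.ne']
      linarith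
    refine ⟨⟨_, hq⟩, ⟨hc, ?_⟩, rfl⟩
    have : slowTriangleMap ⟨_, hq⟩ = p := by
      apply Subtype.ext
      rw [slowTriangleMap_of_notMem hc]
      ext
      · simp only; field_simp; ring
      · simp only; field_simp; ring
    rwa [mem_preimage, this]

lemma measurableSet_image_coe {E : Set closedTriangle} (hE : MeasurableSet E) :
    MeasurableSet (Subtype.val '' E : Set (ℝ × ℝ)) :=
  (MeasurableEmbedding.subtype_coe measurableSet_closedTriangle).measurableSet_image.2 hE

lemma setLIntegral_triangleLebesgue (E : Set closedTriangle) (f : ℝ × ℝ → ℝ≥0∞) :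
    ∫⁻ p in E, f p ∂triangleLebesgue = ∫⁻ p in Subtype.val '' E, f p :=
  setLIntegral_subtype measurableSet_closedTriangle E f

lemma volume_diagonal : volume {p : ℝ × ℝ | p.2 = p.1} = 0 := by
  have h : {p : ℝ × ℝ | p.2 = p.1} =
      (LinearMap.ker (LinearMap.snd ℝ ℝ ℝ - LinearMap.fst ℝ ℝ ℝ) : Set (ℝ × ℝ)) := by
    ext p
    simp [sub_eq_zero]
  rw [h]
  apply Measure.addHaar_submodule
  intro h
  have : ((0, 1) : ℝ × ℝ) ∈ LinearMap.ker (LinearMap.snd ℝ ℝ ℝ - LinearMap.fst ℝ ℝ ℝ) := by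
    rw [h]; trivial
  simp at this

lemma setLIntegral_zeroCell_inter_preimage {E : Set closedTriangle} (hE : MeasurableSet E)
    (f : ℝ × ℝ → ℝ≥0∞) :
    ∫⁻ p in zeroCell ∩ slowTriangleMap ⁻¹' E, f p ∂triangleLebesgue =
      ∫⁻ p in E, ENNReal.ofReal (1 / (1 + p.1.2) ^ 3) * f (1 / (1 + p.1.2), p.1.1 / (1 + p.1.2))
        ∂triangleLebesgue := by
  rw [setLIntegral_triangleLebesgue, image_zeroCell_inter_preimage,
    setLIntegral_triangleLebesgue E (fun p => ENNReal.ofReal (1 / (1 + p.2) ^ 3) *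
      f (1 / (1 + p.2), p.1 / (1 + p.2))),
    lintegral_image_projectiveMap (by simp [det_zeroMatrix])
      ((measurableSet_image_coe hE).inter (measurableSet_lt measurable_snd measurable_fst))]
  · simp only [det_zeroMatrix, abs_one, affineForm_zeroMatrix, projectiveMap_zeroMatrix]
    apply setLIntegral_congr
    refine (inter_subset_left).eventuallyLE.antisymm ?_
    rw [ae_le_set]
    refine measure_mono_null ?_ volume_diagonal
    rintro _ ⟨⟨p, hp, rfl⟩, h⟩
    by_contra hne
    exact h ⟨⟨p, hp, rfl⟩, lt_of_le_of_ne p.2.2.1 hne⟩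
  · rintro _ ⟨⟨p, -, rfl⟩, -⟩
    rw [affineForm_zeroMatrix]
    have := p.2.1
    linarith

lemma setLIntegral_compl_zeroCell_inter_preimage {E : Set closedTriangle} (hE : MeasurableSet E)
    (f : ℝ × ℝ → ℝ≥0∞) :
    ∫⁻ p in zeroCellᶜ ∩ slowTriangleMap ⁻¹' E, f p ∂triangleLebesgue =
      ∫⁻ p in E, ENNReal.ofReal (1 / (1 + p.1.2) ^ 3) *
        f (p.1.1 / (1 + p.1.2), p.1.2 / (1 + p.1.2)) ∂triangleLebesgue := by
  rw [setLIntegral_triangleLebesgue, image_compl_zeroCell_inter_preimage,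
    setLIntegral_triangleLebesgue E (fun p => ENNReal.ofReal (1 / (1 + p.2) ^ 3) *
      f (p.1 / (1 + p.2), p.2 / (1 + p.2))),
    lintegral_image_projectiveMap (by simp [det_oneMatrix]) (measurableSet_image_coe hE)]
  · simp only [det_oneMatrix, abs_one, affineForm_oneMatrix, projectiveMap_oneMatrix]
  · rintro _ ⟨p, -, rfl⟩
    rw [affineForm_oneMatrix]
    have := p.2.1
    linarith

/-! ### The invariant density -/

lemma ae_snd_pos : ∀ᵐ p ∂triangleLebesgue, 0 < p.1.2 := by
  have h : volume {p : ℝ × ℝ | p.2 = 0} = 0 := by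
    have h : {p : ℝ × ℝ | p.2 = 0} = (LinearMap.ker (LinearMap.snd ℝ ℝ ℝ) : Set (ℝ × ℝ)) := by
      ext p
      simp
    rw [h]
    apply Measure.addHaar_submodule
    intro h
    have : ((0, 1) : ℝ × ℝ) ∈ LinearMap.ker (LinearMap.snd ℝ ℝ ℝ) := by rw [h]; trivial
    simp at this
  rw [ae_iff, triangleLebesgue, comap_subtype_coe_apply measurableSet_closedTriangle]
  refine measure_mono_null ?_ h
  rintro _ ⟨p, hp, rfl⟩
  exact le_antisymm (not_lt.1 hp) p.2.1

lemma measurable_density :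
    Measurable fun p : ℝ × ℝ => ENNReal.ofReal (1 / (p.1 * p.2)) := by fun_prop

lemma measurePreserving_slowTriangleMap :
    MeasurePreserving slowTriangleMap slowTriangleMeasure slowTriangleMeasure := by
  refine ⟨measurable_slowTriangleMap, ?_⟩
  ext E hE
  have hpre := measurable_slowTriangleMap hE
  rw [Measure.map_apply measurable_slowTriangleMap hE]
  have hsplit := measure_inter_add_sdiff (μ := slowTriangleMeasure)
    (slowTriangleMap ⁻¹' E) measurableSet_zeroCell
  rw [sdiff_eq, inter_comm, inter_comm _ zeroCellᶜ] at hsplit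
  rw [← hsplit]
  simp only [slowTriangleMeasure]
  rw [withDensity_apply _ (measurableSet_zeroCell.inter hpre),
    withDensity_apply _ (measurableSet_zeroCell.compl.inter hpre), withDensity_apply _ hE,
    setLIntegral_zeroCell_inter_preimage hE fun p => ENNReal.ofReal (1 / (p.1 * p.2)),
    setLIntegral_compl_zeroCell_inter_preimage hE fun p => ENNReal.ofReal (1 / (p.1 * p.2)),
    ← lintegral_add_left (by fun_prop)]
  refine lintegral_congr_ae (ae_restrict_of_ae ?_)
  filter_upwards [ae_snd_pos] with p hp
  have hx : 0 < p.1.1 := hp.trans_le p.2.2.1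
  rw [← ENNReal.ofReal_mul (by positivity), ← ENNReal.ofReal_mul (by positivity),
    ← ENNReal.ofReal_add (by positivity) (by positivity)]
  congr 1
  field_simp
  ring

instance : IsFiniteMeasure triangleLebesgue := by
  refine ⟨?_⟩
  rw [triangleLebesgue, comap_subtype_coe_apply measurableSet_closedTriangle]
  refine (measure_mono (t := Icc (0 : ℝ × ℝ) 1) ?_).trans_lt isCompact_Icc.measure_lt_top
  rintro _ ⟨p, -, rfl⟩
  obtain ⟨h0, h1, h2⟩ := p.2
  exact ⟨⟨h0.trans h1, h0⟩, ⟨h2, h1.trans h2⟩⟩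

instance : SigmaFinite slowTriangleMeasure := SigmaFinite.withDensity_ofReal _

lemma slowTriangleMeasure_absolutelyContinuous : slowTriangleMeasure ≪ triangleLebesgue :=
  withDensity_absolutelyContinuous _ _

lemma triangleLebesgue_absolutelyContinuous : triangleLebesgue ≪ slowTriangleMeasure := by
  apply withDensity_absolutelyContinuous'
  · exact (measurable_density.comp measurable_subtype_coe).aemeasurable
  · filter_upwards [ae_snd_pos] with p hp
    have hx : 0 < p.1.1 := hp.trans_le p.2.2.1
    rw [Ne, ENNReal.ofReal_eq_zero, not_le]
    positivity

/-- The slabs `{x ≥ 1/2, y ≤ 1/n}` decrease to a null set but keep measure at least `1/2`. -/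
lemma slowTriangleMeasure_univ : slowTriangleMeasure univ = ∞ := by
  by_contra hfin
  have : IsFiniteMeasure slowTriangleMeasure := ⟨lt_top_iff_ne_top.2 hfin⟩
  set A : ℕ → Set closedTriangle := fun n =>
    {p | 1 / 2 ≤ p.1.1 ∧ 0 < p.1.2 ∧ p.1.2 ≤ 1 / (n + 2)} with hA
  have hx : Measurable fun p : closedTriangle => p.1.1 := by fun_prop
  have hy : Measurable fun p : closedTriangle => p.1.2 := by fun_prop
  have hAm : ∀ n, MeasurableSet (A n) := fun n =>
    (measurableSet_le measurable_const hx).inter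
      ((measurableSet_lt measurable_const hy).inter (measurableSet_le hy measurable_const))
  have hanti : Antitone A := by
    intro m n hmn p hp
    refine ⟨hp.1, hp.2.1, hp.2.2.trans ?_⟩
    have : (m : ℝ) ≤ n := by exact_mod_cast hmn
    gcongr
  have hempty : ⋂ n, A n = ∅ := by
    rw [eq_empty_iff_forall_notMem]
    intro p hp
    rw [mem_iInter] at hp
    obtain ⟨n, hn⟩ := exists_nat_one_div_lt (hp 0).2.1
    have h1 := (hp n).2.2
    have : (1 : ℝ) / (n + 2) ≤ 1 / (n + 1) := by gcongr; norm_num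
    linarith
  have hlim := tendsto_measure_iInter_atTop (μ := slowTriangleMeasure)
    (fun n => (hAm n).nullMeasurableSet) hanti ⟨0, measure_ne_top _ _⟩
  rw [hempty, measure_empty] at hlim
  have hlow : ∀ n, ENNReal.ofReal (1 / 2) ≤ slowTriangleMeasure (A n) := by
    intro n
    have hn : (0 : ℝ) < n + 2 := by positivity
    have himg : Subtype.val '' A n = Icc (1 / 2 : ℝ) 1 ×ˢ Ioc (0 : ℝ) (1 / (n + 2)) := by
      ext q
      constructor
      · rintro ⟨p, hp, rfl⟩
        exact ⟨⟨hp.1, p.2.2.2⟩, hp.2⟩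
      · rintro ⟨⟨h1, h2⟩, h3, h4⟩
        have h5 : (1 : ℝ) / (n + 2) ≤ 1 / 2 := by gcongr; linarith
        exact ⟨⟨q, h3.le, by linarith, h2⟩, ⟨h1, h3, h4⟩, rfl⟩
    calc ENNReal.ofReal (1 / 2)
        = ENNReal.ofReal (n + 2) * triangleLebesgue (A n) := by
          rw [triangleLebesgue, comap_subtype_coe_apply measurableSet_closedTriangle, himg,
            Measure.volume_eq_prod, Measure.prod_prod, Real.volume_Icc, Real.volume_Ioc,
            ← ENNReal.ofReal_mul (by norm_num), ← ENNReal.ofReal_mul hn.le]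
          congr 1
          field_simp
          norm_num
      _ = ∫⁻ _ in A n, ENNReal.ofReal (n + 2) ∂triangleLebesgue := by
          rw [setLIntegral_const]
      _ ≤ slowTriangleMeasure (A n) := by
          rw [slowTriangleMeasure, withDensity_apply _ (hAm n)]
          refine setLIntegral_mono (measurable_density.comp measurable_subtype_coe) ?_
          intro p hp
          apply ENNReal.ofReal_le_ofReal
          obtain ⟨h1, h2, h3⟩ := hp
          have hx : 0 < p.1.1 := by linarith
          have hx1 := p.2.2.2
          rw [le_div_iff₀ (by positivity)]
          rw [le_div_iff₀ hn] at h3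
          nlinarith
  have := ge_of_tendsto' hlim hlow
  simp at this

/-! ### Averaging over weights -/

/-- The mass `1 / (αβγ)` of the weights `(α, β, γ)` with `β`, `γ` fixed and `α` added repeatedly to
`γ` splits over the children `(β, γ', α + γ')`, up to a remainder. -/
lemma le_of_forall_child_le {H : ℝ → ℝ → ℝ → ℝ} {t u α β : ℝ}
    (hsub : ∀ α β γ, 0 < α → α ≤ β → β ≤ γ → H α β γ ≤ H β γ (α + γ) + H α β (α + γ))
    (ht : ∀ α β γ, 0 < α → α ≤ β → β ≤ γ → H α β γ ≤ t / (α * β * γ))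
    (hα : 0 < α) (hαβ : α ≤ β) (K : ℕ) :
    ∀ γ, β ≤ γ → (∀ γ', γ ≤ γ' → γ' < γ + K * α →
      H β γ' (α + γ') ≤ u / (β * γ' * (α + γ'))) →
      H α β γ ≤ u / (α * β * γ) + (t - u) / (α * β * (γ + K * α)) := by
  induction K with
  | zero =>
    intro γ hβγ _
    refine (ht α β γ hα hαβ hβγ).trans_eq ?_
    simp only [Nat.cast_zero, zero_mul, add_zero]
    ring
  | succ K ih =>
    intro γ hβγ hu
    push_cast at hu ⊢
    have hβ : 0 < β := by linarith
    have hγ : 0 < γ := by linarith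
    have hK : (0 : ℝ) ≤ K := K.cast_nonneg
    have h1 := hu γ le_rfl (by nlinarith)
    have h2 := ih (α + γ) (by linarith) fun γ' h h' => hu γ' (by linarith) (by linarith)
    have e : α + γ + K * α = γ + (K + 1) * α := by ring
    rw [e] at h2
    have e2 : u / (β * γ * (α + γ)) + u / (α * β * (α + γ)) = u / (α * β * γ) := by
      field_simp
    linarith [hsub α β γ hα hαβ hβγ]

/-- A subadditive function of the weights which is nonpositive on balanced weights loses a quarter
of its upper bound. After the weight `γ` has been doubled, half of the mass lies in the
children; these satisfy `γ ≤ 2β`, and the children of such weights are balanced. -/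
lemma le_three_quarters {H : ℝ → ℝ → ℝ → ℝ} {t : ℝ} (h0 : 0 ≤ t)
    (hsub : ∀ α β γ, 0 < α → α ≤ β → β ≤ γ → H α β γ ≤ H β γ (α + γ) + H α β (α + γ))
    (ht : ∀ α β γ, 0 < α → α ≤ β → β ≤ γ → H α β γ ≤ t / (α * β * γ))
    (hgood : ∀ α β γ, 0 < α → α ≤ β → β ≤ γ → γ ≤ 8 * α → H α β γ ≤ 0)
    (α β γ : ℝ) (hα : 0 < α) (hαβ : α ≤ β) (hβγ : β ≤ γ) :
    H α β γ ≤ (3 / 4 * t) / (α * β * γ) := by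
  have hstep : ∀ u : ℝ, u ≤ t → ∀ α β γ, 0 < α → α ≤ β → β ≤ γ →
      (∀ γ', γ ≤ γ' → γ' < 3 * γ → H β γ' (α + γ') ≤ u / (β * γ' * (α + γ'))) →
      H α β γ ≤ ((t + u) / 2) / (α * β * γ) := by
    intro u hut α β γ hα hαβ hβγ hu
    have hβ : 0 < β := by linarith
    have hγ : 0 < γ := by linarith
    have hK := Nat.le_ceil (γ / α)
    have hK' := Nat.ceil_lt_add_one (div_pos hγ hα).le
    set K := ⌈γ / α⌉₊
    rw [div_le_iff₀ hα] at hK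
    have hK'' : K * α < γ + α := by
      calc K * α < (γ / α + 1) * α := by gcongr
        _ = γ + α := by field_simp
    refine (le_of_forall_child_le hsub ht hα hαβ K γ hβγ
      fun γ' h h' => hu γ' h (by linarith)).trans ?_
    have : (t - u) / (α * β * (γ + K * α)) ≤ (t - u) / (α * β * (2 * γ)) := by
      have : 0 ≤ t - u := by linarith
      gcongr
      linarith
    have e : u / (α * β * γ) + (t - u) / (α * β * (2 * γ)) = ((t + u) / 2) / (α * β * γ) := by
      field_simp
      ring
    linarith
  have h1 : ∀ α β γ, 0 < α → α ≤ β → β ≤ γ → γ ≤ 2 * β → H α β γ ≤ (t / 2) / (α * β * γ) := by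
    intro α β γ hα hαβ hβγ h2
    have := hstep 0 h0 α β γ hα hαβ hβγ fun γ' h h' => by
      rw [zero_div]
      exact hgood β γ' _ (by linarith) (by linarith) (by linarith) (by linarith)
    simpa using this
  have := hstep (t / 2) (by linarith) α β γ hα hαβ hβγ fun γ' h h' =>
    h1 β γ' _ (by linarith) (by linarith) (by linarith) (by linarith)
  refine this.trans_eq ?_
  ring

/-- A bound by a multiple of the total mass `1 / (αβγ)` propagates from balanced weights to all
weights. -/
lemma le_of_le_on_balanced {G : ℝ → ℝ → ℝ → ℝ} {C κ : ℝ} (hκC : κ ≤ C)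
    (hsub : ∀ α β γ, 0 < α → α ≤ β → β ≤ γ → G α β γ ≤ G β γ (α + γ) + G α β (α + γ))
    (hC : ∀ α β γ, 0 < α → α ≤ β → β ≤ γ → G α β γ ≤ C / (α * β * γ))
    (hgood : ∀ α β γ, 0 < α → α ≤ β → β ≤ γ → γ ≤ 8 * α → G α β γ ≤ κ / (α * β * γ))
    (α β γ : ℝ) (hα : 0 < α) (hαβ : α ≤ β) (hβγ : β ≤ γ) :
    G α β γ ≤ κ / (α * β * γ) := by
  set H : ℝ → ℝ → ℝ → ℝ := fun α β γ => G α β γ - κ / (α * β * γ) with hH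
  have hHsub : ∀ α β γ, 0 < α → α ≤ β → β ≤ γ → H α β γ ≤ H β γ (α + γ) + H α β (α + γ) := by
    intro α β γ hα hαβ hβγ
    have hβ : 0 < β := by linarith
    have hγ : 0 < γ := by linarith
    have e : κ / (β * γ * (α + γ)) + κ / (α * β * (α + γ)) = κ / (α * β * γ) := by
      field_simp
    have := hsub α β γ hα hαβ hβγ
    simp only [hH]
    linarith
  have hHgood : ∀ α β γ, 0 < α → α ≤ β → β ≤ γ → γ ≤ 8 * α → H α β γ ≤ 0 :=
    fun α β γ h1 h2 h3 h4 => sub_nonpos.2 (hgood α β γ h1 h2 h3 h4)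
  have hiter : ∀ n : ℕ, ∀ α β γ, 0 < α → α ≤ β → β ≤ γ →
      H α β γ ≤ ((3 / 4) ^ n * (C - κ)) / (α * β * γ) := by
    intro n
    induction n with
    | zero =>
      intro α β γ hα hαβ hβγ
      have := hC α β γ hα hαβ hβγ
      simp only [hH, pow_zero, one_mul, sub_div]
      linarith
    | succ n ih =>
      intro α β γ hα hαβ hβγ
      have h0 : 0 ≤ (3 / 4 : ℝ) ^ n * (C - κ) := mul_nonneg (by positivity) (by linarith)
      refine (le_three_quarters h0 hHsub ih hHgood α β γ hα hαβ hβγ).trans_eq ?_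
      ring
  have hlim : Filter.Tendsto (fun n : ℕ => ((3 / 4 : ℝ) ^ n * (C - κ)) / (α * β * γ))
      Filter.atTop (nhds (0 * (C - κ) / (α * β * γ))) :=
    ((tendsto_pow_atTop_nhds_zero_of_lt_one (by norm_num) (by norm_num)).mul_const _).div_const _
  have := ge_of_tendsto' hlim fun n => hiter n α β γ hα hαβ hβγ
  rw [zero_mul, zero_div] at this
  exact sub_nonpos.1 this

/-! ### Weighted masses -/

/-- The affine function on the triangle with values `α`, `β`, `γ` at the vertices `(0, 0)`,
`(1, 0)`, `(1, 1)`. -/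
def weightForm (α β γ : ℝ) (p : ℝ × ℝ) : ℝ := α + (β - α) * p.1 + (γ - β) * p.2

/-- The integral over `E` of the inverse cube of `weightForm α β γ`. When `α`, `β`, `γ` are the
denominators at the vertices of the image of the triangle under a composition `φ` of inverse
branches, this is the Lebesgue measure of `φ '' E`. -/
noncomputable def weightedMass (α β γ : ℝ) (E : Set closedTriangle) : ℝ≥0∞ :=
  ∫⁻ p in E, ENNReal.ofReal (1 / weightForm α β γ p ^ 3) ∂triangleLebesgue

lemma weightForm_pos {α β γ : ℝ} (hα : 0 < α) (hβ : 0 < β) (hγ : 0 < γ) {p : ℝ × ℝ}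
    (hp : p ∈ closedTriangle) : 0 < weightForm α β γ p := by
  obtain ⟨h0, h1, h2⟩ := hp
  have e : weightForm α β γ p = α * (1 - p.1) + β * (p.1 - p.2) + γ * p.2 := by
    unfold weightForm; ring
  rw [e]
  have a1 := mul_nonneg hα.le (sub_nonneg.2 h2)
  have a2 := mul_nonneg hβ.le (sub_nonneg.2 h1)
  have a3 := mul_nonneg hγ.le h0
  rcases h0.eq_or_lt with h | h
  · rcases h1.eq_or_lt with h' | h'
    · have : 0 < α * (1 - p.1) := mul_pos hα (by linarith)
      linarith
    · have : 0 < β * (p.1 - p.2) := mul_pos hβ (by linarith)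
      linarith
  · have : 0 < γ * p.2 := mul_pos hγ h
    linarith

lemma weightForm_le {α β γ : ℝ} (hαβ : α ≤ β) (hβγ : β ≤ γ) {p : ℝ × ℝ}
    (hp : p ∈ closedTriangle) : weightForm α β γ p ≤ γ := by
  obtain ⟨h0, h1, h2⟩ := hp
  unfold weightForm
  nlinarith

lemma weightedMass_zeroCell (α β γ : ℝ) {E : Set closedTriangle}
    (hE : MeasurableSet E) :
    weightedMass α β γ (zeroCell ∩ slowTriangleMap ⁻¹' E) = weightedMass β γ (α + γ) E := by
  unfold weightedMass
  rw [setLIntegral_zeroCell_inter_preimage hE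
    fun p => ENNReal.ofReal (1 / weightForm α β γ p ^ 3)]
  refine lintegral_congr fun p => ?_
  have hd : 0 < 1 + p.1.2 := by linarith [p.2.1]
  rw [← ENNReal.ofReal_mul (by positivity), div_mul_div_comm, one_mul, ← mul_pow]
  congr 3
  simp only [weightForm]
  field_simp
  ring

lemma weightedMass_compl_zeroCell (α β γ : ℝ) {E : Set closedTriangle}
    (hE : MeasurableSet E) :
    weightedMass α β γ (zeroCellᶜ ∩ slowTriangleMap ⁻¹' E) = weightedMass α β (α + γ) E := by
  unfold weightedMass
  rw [setLIntegral_compl_zeroCell_inter_preimage hE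
    fun p => ENNReal.ofReal (1 / weightForm α β γ p ^ 3)]
  refine lintegral_congr fun p => ?_
  have hd : 0 < 1 + p.1.2 := by linarith [p.2.1]
  rw [← ENNReal.ofReal_mul (by positivity), div_mul_div_comm, one_mul, ← mul_pow]
  congr 3
  simp only [weightForm]
  field_simp
  ring

lemma weightedMass_one (E : Set closedTriangle) :
    weightedMass 1 1 1 E = triangleLebesgue E := by
  simp [weightedMass, weightForm]

/-- The projective map which fixes the vertices of the triangle and has weights `α`, `β`, `γ` there
permutes the triangle, and its Jacobian is `αβγ` over the cube of `weightForm α β γ`. -/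
lemma weightedMass_univ {α β γ : ℝ} (hα : 0 < α) (hβ : 0 < β) (hγ : 0 < γ) :
    weightedMass α β γ univ = triangleLebesgue univ * ENNReal.ofReal (1 / (α * β * γ)) := by
  set N : Matrix (Fin 3) (Fin 3) ℝ := !![α, β - α, γ - β; 0, β, γ - β; 0, 0, γ] with hN
  have hdet : N.det = α * β * γ := by simp [hN, Matrix.det_fin_three]
  have h0 : affineForm N 0 = weightForm α β γ := by
    funext p; simp [hN, affineForm, weightForm]
  have hmap : ∀ p, projectiveMap N p = ((β * p.1 + (γ - β) * p.2) / weightForm α β γ p,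
      γ * p.2 / weightForm α β γ p) := by
    intro p; simp [hN, projectiveMap, affineForm, weightForm]
  have himg : projectiveMap N '' closedTriangle = closedTriangle := by
    ext q
    constructor
    · rintro ⟨p, hp, rfl⟩
      have hw := weightForm_pos hα hβ hγ hp
      rw [hmap]
      obtain ⟨h0, h1, h2⟩ := hp
      refine ⟨by positivity, ?_, ?_⟩
      · simp only
        gcongr
        nlinarith
      · rw [div_le_one hw]
        unfold weightForm
        nlinarith
    -- The inverse map has the weights `α⁻¹`, `β⁻¹`, `γ⁻¹`.
    · intro hq
      have hw := weightForm_pos (inv_pos.2 hα) (inv_pos.2 hβ) (inv_pos.2 hγ) hq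
      have hw' := hw.ne'
      obtain ⟨h0, h1, h2⟩ := hq
      set w := weightForm α⁻¹ β⁻¹ γ⁻¹ q with hwdef
      have hwv : w * (α * β * γ) = β * γ * (1 - q.1) + α * γ * (q.1 - q.2) + α * β * q.2 := by
        rw [hwdef, weightForm]; field_simp; ring
      have h3 : 0 ≤ β⁻¹ * (q.1 - q.2) := mul_nonneg (inv_pos.2 hβ).le (by linarith)
      have h4 : 0 ≤ α⁻¹ * (1 - q.1) := mul_nonneg (inv_pos.2 hα).le (by linarith)
      have hform : weightForm α β γ
          ((β⁻¹ * (q.1 - q.2) + γ⁻¹ * q.2) / w, γ⁻¹ * q.2 / w) = 1 / w := by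
        rw [weightForm]
        field_simp
        linear_combination hwv
      refine ⟨((β⁻¹ * (q.1 - q.2) + γ⁻¹ * q.2) / w, γ⁻¹ * q.2 / w), ⟨?_, ?_, ?_⟩, ?_⟩
      · positivity
      · simp only
        gcongr
        linarith
      · rw [div_le_one hw, hwdef, weightForm]
        linarith
      · rw [hmap, hform]
        ext
        · simp only; field_simp; ring
        · simp only; field_simp
  have key := lintegral_image_projectiveMap (N := N) (by rw [hdet]; positivity)
    measurableSet_closedTriangle (fun p hp => by rw [h0]; exact weightForm_pos hα hβ hγ hp)
    (fun _ => 1)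
  rw [himg, hdet, h0] at key
  simp only [mul_one] at key
  have hL : triangleLebesgue univ = ∫⁻ _ in closedTriangle, (1 : ℝ≥0∞) := by
    rw [triangleLebesgue, comap_subtype_coe_apply measurableSet_closedTriangle, image_univ,
      Subtype.range_coe, setLIntegral_one]
  have hpos : 0 < α * β * γ := by positivity
  rw [weightedMass, setLIntegral_triangleLebesgue univ
    (fun p => ENNReal.ofReal (1 / weightForm α β γ p ^ 3)), image_univ, Subtype.range_coe, hL, key,
    mul_comm, ← lintegral_const_mul']
  · refine setLIntegral_congr_fun measurableSet_closedTriangle fun p hp => ?_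
    have hw := weightForm_pos hα hβ hγ hp
    rw [← ENNReal.ofReal_mul (by positivity)]
    congr 1
    rw [abs_of_pos hpos]
    field_simp
  · exact ENNReal.ofReal_ne_top

lemma weightedMass_ne_top {α β γ : ℝ} (hα : 0 < α) (hβ : 0 < β) (hγ : 0 < γ)
    (E : Set closedTriangle) : weightedMass α β γ E ≠ ∞ := by
  refine ne_top_of_le_ne_top ?_ (lintegral_mono_set (subset_univ E))
  change weightedMass α β γ univ ≠ ∞
  rw [weightedMass_univ hα hβ hγ]
  exact ENNReal.mul_ne_top (measure_ne_top _ _) ENNReal.ofReal_ne_top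

lemma weightedMass_mono {α β γ : ℝ} {E E' : Set closedTriangle} (h : E ⊆ E') :
    weightedMass α β γ E ≤ weightedMass α β γ E' := lintegral_mono_set h

lemma weightedMass_union_le (α β γ : ℝ) (E E' : Set closedTriangle) :
    weightedMass α β γ (E ∪ E') ≤ weightedMass α β γ E + weightedMass α β γ E' :=
  lintegral_union_le _ _ _

lemma weightedMass_univ_toReal {α β γ : ℝ} (hα : 0 < α) (hβ : 0 < β) (hγ : 0 < γ) :
    (weightedMass α β γ univ).toReal = (triangleLebesgue univ).toReal / (α * β * γ) := by
  rw [weightedMass_univ hα hβ hγ, ENNReal.toReal_mul, ENNReal.toReal_ofReal (by positivity)]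
  ring

lemma subset_of_subset_preimage {E : Set closedTriangle} (h : E ⊆ slowTriangleMap ⁻¹' E) :
    E ⊆ zeroCell ∩ slowTriangleMap ⁻¹' E ∪ zeroCellᶜ ∩ slowTriangleMap ⁻¹' E := by
  intro p hp
  by_cases hc : p ∈ zeroCell
  · exact Or.inl ⟨hc, h hp⟩
  · exact Or.inr ⟨hc, h hp⟩

lemma toReal_weightedMass_le_add {E : Set closedTriangle} (hE : MeasurableSet E)
    (h : E ⊆ slowTriangleMap ⁻¹' E) (α β γ : ℝ) (hα : 0 < α) (hαβ : α ≤ β) (hβγ : β ≤ γ) :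
    (weightedMass α β γ E).toReal ≤
      (weightedMass β γ (α + γ) E).toReal + (weightedMass α β (α + γ) E).toReal := by
  have hβ : 0 < β := by linarith
  have hγ : 0 < γ := by linarith
  have hαγ : 0 < α + γ := by linarith
  rw [← ENNReal.toReal_add (weightedMass_ne_top hβ hγ hαγ E) (weightedMass_ne_top hα hβ hαγ E)]
  refine ENNReal.toReal_mono (ENNReal.add_ne_top.2
    ⟨weightedMass_ne_top hβ hγ hαγ E, weightedMass_ne_top hα hβ hαγ E⟩) ?_
  rw [← weightedMass_zeroCell α β γ hE, ← weightedMass_compl_zeroCell α β γ hE]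
  exact (weightedMass_mono (subset_of_subset_preimage h)).trans (weightedMass_union_le _ _ _ _ _)

lemma toReal_weightedMass_le {α β γ : ℝ} (hα : 0 < α) (hβ : 0 < β) (hγ : 0 < γ)
    (E : Set closedTriangle) :
    (weightedMass α β γ E).toReal ≤ (triangleLebesgue univ).toReal / (α * β * γ) := by
  rw [← weightedMass_univ_toReal hα hβ hγ]
  exact ENNReal.toReal_mono (weightedMass_ne_top hα hβ hγ _) (weightedMass_mono (subset_univ E))

/-! ### Recurrence -/

/-- The points which spend three consecutive times, starting now, in `Γ₀`. -/
def tripleCell : Set closedTriangle :=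
  zeroCell ∩ slowTriangleMap ⁻¹' (zeroCell ∩ slowTriangleMap ⁻¹' zeroCell)

lemma measurableSet_tripleCell : MeasurableSet tripleCell :=
  measurableSet_zeroCell.inter (measurable_slowTriangleMap
    (measurableSet_zeroCell.inter (measurable_slowTriangleMap measurableSet_zeroCell)))

/-- On balanced weights, `tripleCell` has at least `1 / 360` of the total mass. -/
lemma toReal_weightedMass_le_of_disjoint_tripleCell {E : Set closedTriangle}
    (hE : MeasurableSet E) (h : E ⊆ slowTriangleMap ⁻¹' E) (hd : Disjoint E tripleCell) {κ : ℝ}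
    (h0 : 0 ≤ κ) (hκ : ∀ α β γ, 0 < α → α ≤ β → β ≤ γ →
      (weightedMass α β γ E).toReal ≤ κ / (α * β * γ))
    (α β γ : ℝ) (hα : 0 < α) (hαβ : α ≤ β) (hβγ : β ≤ γ) (hγα : γ ≤ 8 * α) :
    (weightedMass α β γ E).toReal ≤ (359 / 360 * κ) / (α * β * γ) := by
  have hβ : 0 < β := by linarith
  have hγ : 0 < γ := by linarith
  set T := slowTriangleMap ⁻¹' E
  have hT : MeasurableSet T := measurable_slowTriangleMap hE
  set E1 := zeroCellᶜ ∩ T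
  have hE1 : MeasurableSet E1 := measurableSet_zeroCell.compl.inter hT
  set E2 := zeroCell ∩ slowTriangleMap ⁻¹' E1
  have hE2 : MeasurableSet E2 := measurableSet_zeroCell.inter (measurable_slowTriangleMap hE1)
  set E3 := zeroCell ∩ slowTriangleMap ⁻¹' E2
  -- An orbit from `E` starts with the symbols `1`, `01` or `001`; the start `000` is excluded.
  have hsub : E ⊆ E1 ∪ (E2 ∪ E3) := by
    intro p hp
    have hp1 : slowTriangleMap p ∈ E := h hp
    have hp2 : slowTriangleMap (slowTriangleMap p) ∈ E := h hp1
    have hp3 : slowTriangleMap (slowTriangleMap (slowTriangleMap p)) ∈ E := h hp2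
    by_cases c1 : p ∈ zeroCell
    · by_cases c2 : slowTriangleMap p ∈ zeroCell
      · by_cases c3 : slowTriangleMap (slowTriangleMap p) ∈ zeroCell
        · exact (disjoint_left.1 hd hp ⟨c1, c2, c3⟩).elim
        · exact Or.inr (Or.inr ⟨c1, c2, c3, hp3⟩)
      · exact Or.inr (Or.inl ⟨c1, c2, hp2⟩)
    · exact Or.inl ⟨c1, hp1⟩
  have hle : weightedMass α β γ E ≤ weightedMass α β (α + γ) E +
      (weightedMass β γ (β + (α + γ)) E +
        weightedMass γ (α + γ) (γ + (β + (α + γ))) E) := by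
    refine (weightedMass_mono hsub).trans ((weightedMass_union_le _ _ _ _ _).trans ?_)
    refine add_le_add ?_ ((weightedMass_union_le _ _ _ _ _).trans (add_le_add ?_ ?_))
    · rw [weightedMass_compl_zeroCell α β γ hE]
    · rw [weightedMass_zeroCell α β γ hE1, weightedMass_compl_zeroCell β γ _ hE]
    · rw [weightedMass_zeroCell α β γ hE2, weightedMass_zeroCell β γ _ hE1,
        weightedMass_compl_zeroCell γ _ _ hE]
  have n1 := weightedMass_ne_top (α := α) (β := β) (γ := α + γ) hα hβ (by linarith) E
  have n2 := weightedMass_ne_top (α := β) (β := γ) (γ := β + (α + γ)) hβ hγ (by linarith) E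
  have n3 := weightedMass_ne_top (α := γ) (β := α + γ) (γ := γ + (β + (α + γ))) hγ
    (by linarith) (by linarith) E
  have hle' := ENNReal.toReal_mono
    (ENNReal.add_ne_top.2 ⟨n1, ENNReal.add_ne_top.2 ⟨n2, n3⟩⟩) hle
  rw [ENNReal.toReal_add n1 (ENNReal.add_ne_top.2 ⟨n2, n3⟩), ENNReal.toReal_add n2 n3] at hle'
  have k1 := hκ α β (α + γ) hα hαβ (by linarith)
  have k2 := hκ β γ (β + (α + γ)) hβ hβγ (by linarith)
  have k3 := hκ γ (α + γ) (γ + (β + (α + γ))) hγ (by linarith) (by linarith)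
  -- The masses of the four cylinders `1`, `01`, `001`, `000` add up to the total mass.
  have e : κ / (α * β * (α + γ)) + (κ / (β * γ * (β + (α + γ))) +
      κ / (γ * (α + γ) * (γ + (β + (α + γ))))) = κ / (α * β * γ) -
        κ / ((α + γ) * (β + (α + γ)) * (γ + (β + (α + γ)))) := by
    have : α + γ ≠ 0 := by positivity
    have : β + (α + γ) ≠ 0 := by positivity
    have : γ + (β + (α + γ)) ≠ 0 := by positivity
    field_simp
    ring
  have b : κ / (360 * (α * β * γ)) ≤
      κ / ((α + γ) * (β + (α + γ)) * (γ + (β + (α + γ)))) := by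
    refine div_le_div_of_nonneg_left h0 (by positivity) ?_
    calc (α + γ) * (β + (α + γ)) * (γ + (β + (α + γ))) ≤ (9 * α) * (10 * β) * (4 * γ) := by
          gcongr <;> linarith
      _ = 360 * (α * β * γ) := by ring
  have e2 : (359 / 360 * κ) / (α * β * γ) = κ / (α * β * γ) - κ / (360 * (α * β * γ)) := by
    field_simp
    ring
  linarith

lemma measure_eq_zero_of_disjoint_tripleCell {E : Set closedTriangle} (hE : MeasurableSet E)
    (h : E ⊆ slowTriangleMap ⁻¹' E) (hd : Disjoint E tripleCell) : triangleLebesgue E = 0 := by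
  set M := (triangleLebesgue univ).toReal
  have hM : 0 ≤ M := ENNReal.toReal_nonneg
  have hiter : ∀ n : ℕ, ∀ α β γ, 0 < α → α ≤ β → β ≤ γ →
      (weightedMass α β γ E).toReal ≤ ((359 / 360) ^ n * M) / (α * β * γ) := by
    intro n
    induction n with
    | zero =>
      intro α β γ hα hαβ hβγ
      simpa using toReal_weightedMass_le hα (by linarith) (by linarith) E
    | succ n ih =>
      have := le_of_le_on_balanced (κ := 359 / 360 * ((359 / 360) ^ n * M))
        (by have : 0 ≤ (359 / 360 : ℝ) ^ n * M := by positivity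
            linarith)
        (toReal_weightedMass_le_add hE h) ih
        (toReal_weightedMass_le_of_disjoint_tripleCell hE h hd (by positivity) ih)
      intro α β γ hα hαβ hβγ
      refine (this α β γ hα hαβ hβγ).trans_eq ?_
      ring
  have hlim : Filter.Tendsto (fun n : ℕ => (359 / 360 : ℝ) ^ n * M) Filter.atTop (nhds (0 * M)) :=
    (tendsto_pow_atTop_nhds_zero_of_lt_one (by norm_num) (by norm_num)).mul_const _
  have := ge_of_tendsto' hlim (b := (triangleLebesgue E).toReal) fun n => by
    have := hiter n 1 1 1 one_pos le_rfl le_rfl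
    rw [weightedMass_one] at this
    simpa using this
  rw [zero_mul] at this
  have h0 := le_antisymm this ENNReal.toReal_nonneg
  exact (ENNReal.toReal_eq_zero_iff _).1 h0 |>.resolve_right (measure_ne_top _ _)

lemma quasiMeasurePreserving_slowTriangleMap :
    Measure.QuasiMeasurePreserving slowTriangleMap triangleLebesgue triangleLebesgue :=
  measurePreserving_slowTriangleMap.quasiMeasurePreserving.mono
    triangleLebesgue_absolutelyContinuous slowTriangleMeasure_absolutelyContinuous

lemma ae_frequently_mem_tripleCell :
    ∀ᵐ p ∂triangleLebesgue, ∀ n : ℕ, ∃ m, n ≤ m ∧ slowTriangleMap^[m] p ∈ tripleCell := by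
  set Z : Set closedTriangle := ⋂ m : ℕ, slowTriangleMap^[m] ⁻¹' tripleCellᶜ with hZ
  have hZm : MeasurableSet Z := MeasurableSet.iInter fun m =>
    (measurable_slowTriangleMap.iterate m) measurableSet_tripleCell.compl
  have h0 : triangleLebesgue Z = 0 := by
    apply measure_eq_zero_of_disjoint_tripleCell hZm
    · intro p hp
      simp only [hZ, mem_preimage, mem_iInter] at hp ⊢
      intro m
      have := hp (m + 1)
      rwa [Function.iterate_succ_apply] at this
    · rw [disjoint_left]
      intro p hp
      exact mem_iInter.1 hp 0
  rw [ae_all_iff]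
  intro n
  have := (quasiMeasurePreserving_slowTriangleMap.iterate n).preimage_null h0
  rw [ae_iff]
  refine measure_mono_null ?_ this
  intro p hp
  simp only [mem_preimage, hZ, mem_iInter]
  intro m hm
  apply hp
  exact ⟨m + n, Nat.le_add_left _ _, by rwa [Function.iterate_add_apply]⟩

/-- A measure-preserving map is conservative if almost every orbit visits a fixed set of finite
measure infinitely often. The times `n ≤ N` at which a set `W` without returns visits `Y` give
disjoint subsets of the `N`-th preimage of `Y`, so that the expected number of visits is at most
the measure of `Y`. -/
lemma conservative_of_ae_frequently_mem {X : Type*} [MeasurableSpace X] {μ : Measure X}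
    {T : X → X} (hT : MeasurePreserving T μ μ) {Y : Set X} (hY : MeasurableSet Y)
    (hfin : μ Y ≠ ∞) (hfreq : ∀ᵐ x ∂μ, ∀ n : ℕ, ∃ m, n ≤ m ∧ T^[m] x ∈ Y) :
    Conservative T μ := by
  refine ⟨hT.quasiMeasurePreserving, fun W hW hW0 => ?_⟩
  by_contra hret
  push Not at hret
  have hm : ∀ n, Measurable T^[n] := fun n => hT.measurable.iterate n
  have hpart : ∀ N : ℕ, ∑ n ∈ Finset.range N, μ (W ∩ T^[n] ⁻¹' Y) ≤ μ Y := by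
    intro N
    have e : ∀ n ∈ Finset.range N, μ (W ∩ T^[n] ⁻¹' Y) =
        μ (T^[N - n] ⁻¹' W ∩ T^[N] ⁻¹' Y) := by
      intro n hn
      have hn' := (Finset.mem_range.1 hn).le
      rw [← (hT.iterate (N - n)).measure_preimage
        (hW.inter (hm n hY)).nullMeasurableSet, preimage_inter, ← preimage_comp,
        ← Function.iterate_add, Nat.add_sub_cancel' hn']
    rw [Finset.sum_congr rfl e, ← measure_biUnion_finset]
    · rw [← (hT.iterate N).measure_preimage hY.nullMeasurableSet]
      exact measure_mono (iUnion₂_subset fun _ _ => inter_subset_right)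
    · intro i hi j hj hij
      have key : ∀ a b : ℕ, b < a → ∀ x, T^[b] x ∈ W → T^[a] x ∉ W := by
        intro a b hab x hx hx'
        refine hret _ hx (a - b) (by omega) ?_
        rwa [← Function.iterate_add_apply, Nat.sub_add_cancel hab.le]
      have hi' : i < N := by simpa using hi
      have hj' : j < N := by simpa using hj
      rw [Function.onFun, disjoint_left]
      rintro x ⟨hx, -⟩ ⟨hx', -⟩
      rcases lt_or_gt_of_ne hij with h | h
      · exact key (N - i) (N - j) (by omega) x hx' hx
      · exact key (N - j) (N - i) (by omega) x hx hx'
    · exact fun n _ => (hm _ hW).inter (hm _ hY)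
  have hsum : ∑' n, μ (W ∩ T^[n] ⁻¹' Y) ≠ ∞ := by
    refine ne_top_of_le_ne_top hfin ?_
    rw [ENNReal.tsum_eq_iSup_nat]
    exact iSup_le hpart
  have hae := ae_eventually_notMem hsum
  apply hW0
  rw [measure_eq_zero_iff_ae_notMem]
  filter_upwards [hae, hfreq] with x hx hx' hxW
  obtain ⟨n, hn⟩ := Filter.eventually_atTop.1 hx
  obtain ⟨m, hnm, hmY⟩ := hx' n
  exact hn m hnm ⟨hxW, hmY⟩

lemma conservative_slowTriangleMap : Conservative slowTriangleMap slowTriangleMeasure := by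
  refine conservative_of_ae_frequently_mem measurePreserving_slowTriangleMap
    measurableSet_tripleCell ?_
    (slowTriangleMeasure_absolutelyContinuous.ae_le ae_frequently_mem_tripleCell)
  rw [slowTriangleMeasure, withDensity_apply _ measurableSet_tripleCell]
  have hle : ∫⁻ p in tripleCell, ENNReal.ofReal (1 / (p.1.1 * p.1.2)) ∂triangleLebesgue ≤
      ∫⁻ _ in tripleCell, ENNReal.ofReal 9 ∂triangleLebesgue := by
    refine setLIntegral_mono measurable_const fun p hp => ENNReal.ofReal_le_ofReal ?_
    -- `y > 1 - x` and `y > 2x - 1` bound the second coordinate from below by `1 / 3`.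
    have h1 := mem_zeroCell.1 hp.1
    have h2 := mem_zeroCell.1 hp.2.1
    rw [slowTriangleMap_of_mem hp.1] at h2
    obtain ⟨h3, h4, h5⟩ := p.2
    have hx : 0 < p.1.1 := by linarith
    rw [sub_lt_iff_lt_add, ← add_div, lt_div_iff₀ hx] at h2
    have hy : 1 / 3 < p.1.2 := by linarith
    rw [div_le_iff₀ (mul_pos hx (by linarith))]
    nlinarith
  refine ne_top_of_le_ne_top ?_ hle
  rw [setLIntegral_const]
  exact ENNReal.mul_ne_top ENNReal.ofReal_ne_top (measure_ne_top _ _)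

/-! ### Shrinking of cylinders -/

/-- The weighted mean `(a • P + c • R) / (a + c)`. -/
noncomputable def mediant (a c : ℝ) (P R : ℝ × ℝ) : ℝ × ℝ := (a + c)⁻¹ • (a • P + c • R)

lemma dist_mediant_le {a c : ℝ} (ha : 0 < a) (hc : 0 < c) (X P R : ℝ × ℝ) :
    dist X (mediant a c P R) ≤ (a * dist X P + c * dist X R) / (a + c) := by
  have hac : 0 < a + c := by linarith
  have e : X - mediant a c P R = (a + c)⁻¹ • (a • (X - P) + c • (X - R)) := by
    rw [mediant]
    ext
    · simp; field_simp; ring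
    · simp; field_simp; ring
  rw [dist_eq_norm, e, norm_smul, Real.norm_of_nonneg (by positivity), inv_mul_eq_div]
  gcongr
  refine (norm_add_le _ _).trans ?_
  rw [norm_smul, norm_smul, Real.norm_of_nonneg ha.le, Real.norm_of_nonneg hc.le, dist_eq_norm,
    dist_eq_norm]

lemma dist_mediant_le_of_le {a c r : ℝ} (ha : 0 < a) (hc : 0 < c) {X P R : ℝ × ℝ}
    (hP : dist X P ≤ r) (hR : dist X R ≤ r) : dist X (mediant a c P R) ≤ r := by
  refine (dist_mediant_le ha hc X P R).trans ?_
  rw [div_le_iff₀ (by linarith)]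
  nlinarith

/-- A triangle in the plane with vertices `P`, `Q`, `R` carrying the weights `α`, `β`, `γ`. -/
structure WeightedTriangle where
  /-- The weight of the vertex `P`. -/
  α : ℝ
  /-- The weight of the vertex `Q`. -/
  β : ℝ
  /-- The weight of the vertex `R`. -/
  γ : ℝ
  /-- The first vertex. -/
  P : ℝ × ℝ
  /-- The second vertex. -/
  Q : ℝ × ℝ
  /-- The third vertex. -/
  R : ℝ × ℝ

namespace WeightedTriangle

/-- The part of a weighted triangle which corresponds to `Γ₀`: the edge `PR` is cut at the
mediant. -/
noncomputable def zero (T : WeightedTriangle) : WeightedTriangle :=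
  ⟨T.β, T.γ, T.α + T.γ, T.Q, T.R, mediant T.α T.γ T.P T.R⟩

/-- The part of a weighted triangle which corresponds to `Γ₁`. -/
noncomputable def one (T : WeightedTriangle) : WeightedTriangle :=
  ⟨T.α, T.β, T.α + T.γ, T.P, T.Q, mediant T.α T.γ T.P T.R⟩

/-- The projective parametrization of a weighted triangle by the standard one: the weights of the
vertices multiply the barycentric coordinates `(1 - x, x - y, y)`. -/
noncomputable def point (T : WeightedTriangle) (p : ℝ × ℝ) : ℝ × ℝ :=
  (weightForm T.α T.β T.γ p)⁻¹ •
    ((T.α * (1 - p.1)) • T.P + (T.β * (p.1 - p.2)) • T.Q + (T.γ * p.2) • T.R)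

/-- The weights are positive and increasing. -/
def Ordered (T : WeightedTriangle) : Prop := 0 < T.α ∧ T.α ≤ T.β ∧ T.β ≤ T.γ

/-- All sides have length at most `r`. -/
def SidesLE (T : WeightedTriangle) (r : ℝ) : Prop :=
  dist T.P T.Q ≤ r ∧ dist T.Q T.R ≤ r ∧ dist T.P T.R ≤ r

lemma Ordered.zero {T : WeightedTriangle} (h : T.Ordered) : T.zero.Ordered := by
  obtain ⟨h1, h2, h3⟩ := h
  exact ⟨h1.trans_le h2, h3, by simp only [WeightedTriangle.zero]; linarith⟩

lemma Ordered.one {T : WeightedTriangle} (h : T.Ordered) : T.one.Ordered := by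
  obtain ⟨h1, h2, h3⟩ := h
  exact ⟨h1, h2, by simp only [WeightedTriangle.one]; linarith⟩

lemma point_zero {T : WeightedTriangle} (h : T.Ordered) {p : closedTriangle} (hp : p ∈ zeroCell) :
    T.zero.point (slowTriangleMap p) = T.point p := by
  obtain ⟨h1, h2, h3⟩ := h
  have hβ := h1.trans_le h2
  have hγ := hβ.trans_le h3
  have hS := slowTriangleMap_of_mem hp
  have hx : 0 < p.1.1 := by linarith [mem_zeroCell.1 hp, p.2.2.1]
  have hw := weightForm_pos h1 hβ hγ p.2
  have hform : weightForm T.zero.α T.zero.β T.zero.γ (slowTriangleMap p) =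
      weightForm T.α T.β T.γ p / p.1.1 := by
    rw [hS]
    simp only [weightForm, WeightedTriangle.zero]
    field_simp
    ring
  have hαγ : T.α + T.γ ≠ 0 := by positivity
  rw [point, hform, hS, point]
  simp only [WeightedTriangle.zero, mediant]
  ext
  · simp; field_simp; ring
  · simp; field_simp; ring

lemma point_one {T : WeightedTriangle} (h : T.Ordered) {p : closedTriangle} (hp : p ∉ zeroCell)
    (hy : p.1.2 < 1) : T.one.point (slowTriangleMap p) = T.point p := by
  obtain ⟨h1, h2, h3⟩ := h
  have hβ := h1.trans_le h2
  have hγ := hβ.trans_le h3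
  have hS := slowTriangleMap_of_notMem hp
  have hx : 0 < 1 - p.1.2 := by linarith
  have hw := weightForm_pos h1 hβ hγ p.2
  have hform : weightForm T.one.α T.one.β T.one.γ (slowTriangleMap p) =
      weightForm T.α T.β T.γ p / (1 - p.1.2) := by
    rw [hS]
    simp only [weightForm, WeightedTriangle.one]
    field_simp
    ring
  have hαγ : T.α + T.γ ≠ 0 := by positivity
  rw [point, hform, hS, point]
  simp only [WeightedTriangle.one, mediant]
  ext
  · simp; field_simp; ring
  · simp; field_simp; ring

lemma point_mem_of_convex {T : WeightedTriangle} (h : T.Ordered) {p : ℝ × ℝ}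
    (hp : p ∈ closedTriangle) {s : Set (ℝ × ℝ)} (hs : Convex ℝ s) (hP : T.P ∈ s) (hQ : T.Q ∈ s)
    (hR : T.R ∈ s) : T.point p ∈ s := by
  obtain ⟨h1, h2, h3⟩ := h
  have hβ := h1.trans_le h2
  have hγ := hβ.trans_le h3
  have hw := weightForm_pos h1 hβ hγ hp
  obtain ⟨p0, p1, p2⟩ := hp
  have := hs.sum_mem (t := Finset.univ) (w := ![(weightForm T.α T.β T.γ p)⁻¹ * (T.α * (1 - p.1)),
    (weightForm T.α T.β T.γ p)⁻¹ * (T.β * (p.1 - p.2)),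
    (weightForm T.α T.β T.γ p)⁻¹ * (T.γ * p.2)]) (z := ![T.P, T.Q, T.R]) ?_ ?_ ?_
  · rw [Fin.sum_univ_three] at this
    simpa [point, smul_add, mul_smul] using this
  · have := inv_pos.2 hw
    have a1 : 0 ≤ 1 - p.1 := by linarith
    have a2 : 0 ≤ p.1 - p.2 := by linarith
    intro i _
    fin_cases i
    · simp only [Fin.zero_eta, Matrix.cons_val_zero]; positivity
    · simp only [Fin.mk_one, Matrix.cons_val_one, Matrix.cons_val_zero]; positivity
    · simp only [Fin.reduceFinMk, Matrix.cons_val]; positivity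
  · rw [Fin.sum_univ_three]
    simp only [Matrix.cons_val_zero, Matrix.cons_val_one, Matrix.cons_val]
    rw [← mul_add, ← mul_add, inv_mul_eq_one₀ hw.ne', weightForm]
    ring
  · intro i _
    fin_cases i
    · exact hP
    · exact hQ
    · exact hR

lemma dist_point_le {T : WeightedTriangle} (h : T.Ordered) {r : ℝ} (hr : T.SidesLE r)
    {p q : ℝ × ℝ} (hp : p ∈ closedTriangle) (hq : q ∈ closedTriangle) :
    dist (T.point p) (T.point q) ≤ r := by
  obtain ⟨r1, r2, r3⟩ := hr
  have h0 : 0 ≤ r := dist_nonneg.trans r1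
  have aux : ∀ V : ℝ × ℝ, dist T.P V ≤ r → dist T.Q V ≤ r → dist T.R V ≤ r →
      dist (T.point q) V ≤ r := fun V a b c =>
    Metric.mem_closedBall.1 (point_mem_of_convex h hq (convex_closedBall V r) a b c)
  have hP := aux T.P (by simpa using h0) (by rwa [dist_comm]) (by rwa [dist_comm])
  have hQ := aux T.Q r1 (by simpa using h0) (by rwa [dist_comm])
  have hR := aux T.R r3 r2 (by simpa using h0)
  exact Metric.mem_closedBall.1 (point_mem_of_convex h hp (convex_closedBall (T.point q) r)
    (by rwa [Metric.mem_closedBall, dist_comm]) (by rwa [Metric.mem_closedBall, dist_comm])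
    (by rwa [Metric.mem_closedBall, dist_comm]))

lemma SidesLE.zero {T : WeightedTriangle} (h : T.Ordered) {r : ℝ} (hr : T.SidesLE r) :
    T.zero.SidesLE r := by
  obtain ⟨h1, h2, h3⟩ := h
  obtain ⟨r1, r2, r3⟩ := hr
  have hγ : 0 < T.γ := h1.trans_le (h2.trans h3)
  have h0 : 0 ≤ r := dist_nonneg.trans r1
  exact ⟨r2, dist_mediant_le_of_le h1 hγ (by rwa [dist_comm]) (by simpa [WeightedTriangle.zero]),
    dist_mediant_le_of_le h1 hγ (by rwa [dist_comm]) r2⟩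

lemma SidesLE.one {T : WeightedTriangle} (h : T.Ordered) {r : ℝ} (hr : T.SidesLE r) :
    T.one.SidesLE r := by
  obtain ⟨h1, h2, h3⟩ := h
  obtain ⟨r1, r2, r3⟩ := hr
  have hγ : 0 < T.γ := h1.trans_le (h2.trans h3)
  have h0 : 0 ≤ r := dist_nonneg.trans r1
  exact ⟨r1, dist_mediant_le_of_le h1 hγ (by rwa [dist_comm]) r2,
    dist_mediant_le_of_le h1 hγ (by simpa [WeightedTriangle.one]) r3⟩

/-- Three consecutive cuts of type `Γ₀` shorten the sides by a definite factor, whatever the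
weights. -/
lemma SidesLE.zero_zero_zero {T : WeightedTriangle} (h : T.Ordered) {r : ℝ} (hr : T.SidesLE r) :
    T.zero.zero.zero.SidesLE (2 / 3 * r) := by
  obtain ⟨h1, h2, h3⟩ := h
  obtain ⟨r1, r2, r3⟩ := hr
  have hβ := h1.trans_le h2
  have hγ := hβ.trans_le h3
  have h0 : 0 ≤ r := dist_nonneg.trans r1
  have hαγ : 0 < T.α + T.γ := by positivity
  set D := mediant T.α T.γ T.P T.R with hD
  set E := mediant T.β (T.α + T.γ) T.Q D with hE
  have hβD : 0 < T.β + (T.α + T.γ) := by positivity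
  have dDQ : dist D T.Q ≤ r := by
    rw [dist_comm]
    exact dist_mediant_le_of_le h1 hγ (by rwa [dist_comm]) r2
  have dDR : dist D T.R ≤ r := by
    rw [dist_comm]
    exact dist_mediant_le_of_le h1 hγ (by rwa [dist_comm]) (by simpa)
  have dER : dist E T.R ≤ r := by
    rw [dist_comm]
    exact dist_mediant_le_of_le hβ hαγ (by rwa [dist_comm]) (by rwa [dist_comm])
  have dDE := dist_mediant_le hβ hαγ D T.Q D
  rw [← hE, dist_self, mul_zero, add_zero, le_div_iff₀ hβD] at dDE
  have dEF := dist_mediant_le hγ hβD E T.R E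
  rw [dist_self, mul_zero, add_zero] at dEF
  have dDF := dist_mediant_le hγ hβD D T.R E
  refine ⟨?_, dEF.trans ?_, dDF.trans ?_⟩
  · change dist D E ≤ _
    have : dist D E * (T.β + (T.α + T.γ)) ≤ 2 / 3 * r * (T.β + (T.α + T.γ)) := by nlinarith
    exact le_of_mul_le_mul_right this hβD
  · rw [div_le_iff₀ (by positivity)]
    nlinarith
  · rw [div_le_iff₀ (by positivity)]
    nlinarith

open Classical in
/-- The part of `T` which contains the image of `p` after `n` cuts: the itinerary of `p` under the
slow triangle map selects the parts. -/
noncomputable def follow : ℕ → WeightedTriangle → closedTriangle → WeightedTriangle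
  | 0, T, _ => T
  | n + 1, T, p => follow n (if p ∈ zeroCell then T.zero else T.one) (slowTriangleMap p)

lemma follow_succ_of_mem (n : ℕ) (T : WeightedTriangle) {p : closedTriangle}
    (hp : p ∈ zeroCell) : follow (n + 1) T p = follow n T.zero (slowTriangleMap p) := by
  rw [follow, if_pos hp]

lemma follow_succ_of_notMem (n : ℕ) (T : WeightedTriangle) {p : closedTriangle}
    (hp : p ∉ zeroCell) : follow (n + 1) T p = follow n T.one (slowTriangleMap p) := by
  rw [follow, if_neg hp]

lemma follow_add (m n : ℕ) (T : WeightedTriangle) (p : closedTriangle) :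
    follow (m + n) T p = follow n (follow m T p) (slowTriangleMap^[m] p) := by
  induction m generalizing T p with
  | zero => simp [follow]
  | succ m ih =>
    rw [Nat.add_right_comm, Function.iterate_succ_apply]
    by_cases hp : p ∈ zeroCell
    · rw [follow_succ_of_mem _ _ hp, follow_succ_of_mem _ _ hp, ih]
    · rw [follow_succ_of_notMem _ _ hp, follow_succ_of_notMem _ _ hp, ih]

lemma Ordered.follow {T : WeightedTriangle} (h : T.Ordered) (n : ℕ) (p : closedTriangle) :
    (follow n T p).Ordered := by
  induction n generalizing T p with
  | zero => exact h
  | succ n ih =>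
    by_cases hp : p ∈ zeroCell
    · rw [follow_succ_of_mem _ _ hp]; exact ih h.zero _
    · rw [follow_succ_of_notMem _ _ hp]; exact ih h.one _

lemma SidesLE.follow {T : WeightedTriangle} (h : T.Ordered) {r : ℝ} (hr : T.SidesLE r) (n : ℕ)
    (p : closedTriangle) : (follow n T p).SidesLE r := by
  induction n generalizing T p with
  | zero => exact hr
  | succ n ih =>
    by_cases hp : p ∈ zeroCell
    · rw [follow_succ_of_mem _ _ hp]; exact ih h.zero (hr.zero h) _
    · rw [follow_succ_of_notMem _ _ hp]; exact ih h.one (hr.one h) _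

lemma point_follow {T : WeightedTriangle} (h : T.Ordered) (n : ℕ) (p : closedTriangle) :
    (follow n T p).point (slowTriangleMap^[n] p) = T.point p := by
  induction n generalizing T p with
  | zero => rfl
  | succ n ih =>
    rw [Function.iterate_succ_apply]
    by_cases hp : p ∈ zeroCell
    · rw [follow_succ_of_mem _ _ hp, ih h.zero, point_zero h hp]
    · have hy : p.1.2 < 1 := by
        have := mt mem_zeroCell.2 hp
        linarith [p.2.2.1, p.2.1]
      rw [follow_succ_of_notMem _ _ hp, ih h.one, point_one h hp hy]

/-- The standard triangle with weights `1`. -/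
def standard : WeightedTriangle := ⟨1, 1, 1, (0, 0), (1, 0), (1, 1)⟩

lemma ordered_standard : standard.Ordered := ⟨one_pos, le_rfl, le_rfl⟩

lemma point_standard (p : ℝ × ℝ) : standard.point p = p := by
  ext <;> simp [standard, point, weightForm]

lemma sidesLE_standard : standard.SidesLE 1 := by
  simp [SidesLE, standard, Prod.dist_eq]

lemma exists_follow_sidesLE {T : WeightedTriangle} (h : T.Ordered) {r : ℝ} (hr : T.SidesLE r)
    {p : closedTriangle} (hp : ∀ n : ℕ, ∃ m, n ≤ m ∧ slowTriangleMap^[m] p ∈ tripleCell) (k : ℕ) :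
    ∃ n, (follow n T p).SidesLE ((2 / 3) ^ k * r) := by
  induction k with
  | zero => exact ⟨0, by simpa [WeightedTriangle.follow] using hr⟩
  | succ k ih =>
    obtain ⟨n, hn⟩ := ih
    obtain ⟨m, hnm, hm⟩ := hp n
    obtain ⟨d, rfl⟩ := Nat.exists_eq_add_of_le hnm
    have hs := hn.follow (h.follow n p) d (slowTriangleMap^[n] p)
    rw [← follow_add] at hs
    refine ⟨n + d + 3, ?_⟩
    rw [follow_add, follow_succ_of_mem _ _ hm.1, follow_succ_of_mem _ _ hm.2.1,
      follow_succ_of_mem _ _ hm.2.2, pow_succ', mul_assoc]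
    exact hs.zero_zero_zero (h.follow _ _)

end WeightedTriangle

/-- The first `n` symbols of the itineraries of `p` and `q` with respect to `Γ₀` and `Γ₁` agree. -/
def SameItinerary (n : ℕ) (p q : closedTriangle) : Prop :=
  ∀ i < n, slowTriangleMap^[i] p ∈ zeroCell ↔ slowTriangleMap^[i] q ∈ zeroCell

lemma sameItinerary_succ {n : ℕ} {p q : closedTriangle} :
    SameItinerary (n + 1) p q ↔ (p ∈ zeroCell ↔ q ∈ zeroCell) ∧
      SameItinerary n (slowTriangleMap p) (slowTriangleMap q) := by
  constructor
  · exact fun h => ⟨h 0 n.succ_pos, fun i hi => h (i + 1) (by omega)⟩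
  · rintro ⟨h0, h⟩ (_ | i) hi
    · exact h0
    · exact h i (by omega)

lemma SameItinerary.mono {m n : ℕ} (hmn : m ≤ n) {p q : closedTriangle}
    (h : SameItinerary n p q) : SameItinerary m p q := fun i hi => h i (hi.trans_le hmn)

lemma SameItinerary.follow_eq {n : ℕ} {p q : closedTriangle} (h : SameItinerary n p q)
    (T : WeightedTriangle) : WeightedTriangle.follow n T p = WeightedTriangle.follow n T q := by
  induction n generalizing T p q with
  | zero => rfl
  | succ n ih =>
    obtain ⟨h0, h1⟩ := sameItinerary_succ.1 h
    by_cases hp : p ∈ zeroCell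
    · rw [WeightedTriangle.follow_succ_of_mem _ _ hp,
        WeightedTriangle.follow_succ_of_mem _ _ (h0.1 hp), ih h1]
    · rw [WeightedTriangle.follow_succ_of_notMem _ _ hp,
        WeightedTriangle.follow_succ_of_notMem _ _ (mt h0.2 hp), ih h1]

lemma exists_forall_sameItinerary_dist_lt {p : closedTriangle}
    (hp : ∀ n : ℕ, ∃ m, n ≤ m ∧ slowTriangleMap^[m] p ∈ tripleCell) {ε : ℝ} (hε : 0 < ε) :
    ∃ n, ∀ q, SameItinerary n p q → dist p q < ε := by
  obtain ⟨k, hk⟩ := exists_pow_lt_of_lt_one hε (show (2 / 3 : ℝ) < 1 by norm_num)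
  obtain ⟨n, hn⟩ := WeightedTriangle.exists_follow_sidesLE WeightedTriangle.ordered_standard
    WeightedTriangle.sidesLE_standard hp k
  refine ⟨n, fun q hq => ?_⟩
  have h := WeightedTriangle.dist_point_le (WeightedTriangle.ordered_standard.follow n p) hn
    (slowTriangleMap^[n] p).2 (slowTriangleMap^[n] q).2
  rw [WeightedTriangle.point_follow WeightedTriangle.ordered_standard, hq.follow_eq,
    WeightedTriangle.point_follow WeightedTriangle.ordered_standard,
    WeightedTriangle.point_standard, WeightedTriangle.point_standard, mul_one] at h
  exact h.trans_lt hk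

/-! ### Ergodicity -/

/-- The sets which are determined by the first `n` symbols of the itinerary: the finite unions of
cylinders of length `n`. -/
def Determined : ℕ → Set closedTriangle → Prop
  | 0, E => E = ∅ ∨ E = univ
  | n + 1, E => ∃ E0 E1, Determined n E0 ∧ Determined n E1 ∧
      E = zeroCell ∩ slowTriangleMap ⁻¹' E0 ∪ zeroCellᶜ ∩ slowTriangleMap ⁻¹' E1

lemma Determined.measurableSet {n : ℕ} {E : Set closedTriangle} (h : Determined n E) :
    MeasurableSet E := by
  induction n generalizing E with
  | zero => rcases h with rfl | rfl <;> simp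
  | succ n ih =>
    obtain ⟨E0, E1, h0, h1, rfl⟩ := h
    exact (measurableSet_zeroCell.inter (measurable_slowTriangleMap (ih h0))).union
      (measurableSet_zeroCell.compl.inter (measurable_slowTriangleMap (ih h1)))

lemma determined_of_sameItinerary {n : ℕ} {E : Set closedTriangle}
    (h : ∀ p q, SameItinerary n p q → p ∈ E → q ∈ E) : Determined n E := by
  induction n generalizing E with
  | zero =>
    rcases E.eq_empty_or_nonempty with hE | ⟨p, hp⟩
    · exact Or.inl hE
    · exact Or.inr (eq_univ_of_forall fun q => h p q (fun i hi => absurd hi i.not_lt_zero) hp)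
  | succ n ih =>
    have key : ∀ C : Set closedTriangle, Determined n
        {q | ∃ p ∈ E ∩ C, SameItinerary n (slowTriangleMap p) q} := by
      intro C
      apply ih
      rintro p q hpq ⟨p', hp', h'⟩
      exact ⟨p', hp', fun i hi => (h' i hi).trans (hpq i hi)⟩
    refine ⟨_, _, key zeroCell, key zeroCellᶜ, ?_⟩
    ext p
    constructor
    · intro hp
      by_cases hc : p ∈ zeroCell
      · exact Or.inl ⟨hc, p, ⟨hp, hc⟩, fun _ _ => Iff.rfl⟩
      · exact Or.inr ⟨hc, p, ⟨hp, hc⟩, fun _ _ => Iff.rfl⟩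
    · rintro (⟨hc, p', ⟨hp', hc'⟩, h'⟩ | ⟨hc, p', ⟨hp', hc'⟩, h'⟩)
      · exact h p' p (sameItinerary_succ.2 ⟨iff_of_true hc' hc, h'⟩) hp'
      · exact h p' p (sameItinerary_succ.2 ⟨iff_of_false hc' hc, h'⟩) hp'

lemma weightedMass_split (α β γ : ℝ) {E0 E1 : Set closedTriangle} (h0 : MeasurableSet E0)
    (h1 : MeasurableSet E1) :
    weightedMass α β γ (zeroCell ∩ slowTriangleMap ⁻¹' E0 ∪ zeroCellᶜ ∩ slowTriangleMap ⁻¹' E1) =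
      weightedMass β γ (α + γ) E0 + weightedMass α β (α + γ) E1 := by
  rw [← weightedMass_zeroCell α β γ h0, ← weightedMass_compl_zeroCell α β γ h1]
  refine lintegral_union
    (measurableSet_zeroCell.compl.inter (measurable_slowTriangleMap h1)) ?_
  exact disjoint_compl_right.mono inter_subset_left inter_subset_left

/-- An invariant set whose relative mass is bounded by `κ` for all weights has relative measure at
most `κ` in every cylinder, since the passage to a cylinder only changes the weights. -/
lemma weightedMass_inter_determined_le {B : Set closedTriangle} (hB : MeasurableSet B)
    (hinv : slowTriangleMap ⁻¹' B = B) {κ : ℝ≥0∞}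
    (hκ : ∀ α β γ, 0 < α → α ≤ β → β ≤ γ →
      weightedMass α β γ B ≤ κ * weightedMass α β γ univ) {n : ℕ} {E : Set closedTriangle}
    (hE : Determined n E) {α β γ : ℝ} (hα : 0 < α) (hαβ : α ≤ β) (hβγ : β ≤ γ) :
    weightedMass α β γ (B ∩ E) ≤ κ * weightedMass α β γ E := by
  induction n generalizing E α β γ with
  | zero =>
    rcases hE with rfl | rfl
    · simp [weightedMass]
    · simpa using hκ α β γ hα hαβ hβγ
  | succ n ih =>
    obtain ⟨E0, E1, h0, h1, rfl⟩ := hE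
    have e : B ∩ (zeroCell ∩ slowTriangleMap ⁻¹' E0 ∪ zeroCellᶜ ∩ slowTriangleMap ⁻¹' E1) =
        zeroCell ∩ slowTriangleMap ⁻¹' (B ∩ E0) ∪ zeroCellᶜ ∩ slowTriangleMap ⁻¹' (B ∩ E1) := by
      rw [preimage_inter, preimage_inter, hinv, inter_union_distrib_left, inter_left_comm,
        inter_left_comm B zeroCellᶜ]
    rw [e, weightedMass_split _ _ _ (hB.inter h0.measurableSet) (hB.inter h1.measurableSet),
      weightedMass_split _ _ _ h0.measurableSet h1.measurableSet, mul_add]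
    exact add_le_add (ih h0 (by linarith) (by linarith) (by linarith))
      (ih h1 (by linarith) (by linarith) (by linarith))

/-- The cylinders contained in an open set exhaust it up to a null set. -/
lemma measure_inter_isOpen_le {B : Set closedTriangle} {κ : ℝ≥0∞}
    (hκ : ∀ n E, Determined n E → triangleLebesgue (B ∩ E) ≤ κ * triangleLebesgue E)
    {U : Set closedTriangle} (hU : IsOpen U) :
    triangleLebesgue (B ∩ U) ≤ κ * triangleLebesgue U := by
  set V : ℕ → Set closedTriangle := fun n => {p | ∀ q, SameItinerary n p q → q ∈ U} with hV
  have hVdet : ∀ n, Determined n (V n) := by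
    intro n
    refine determined_of_sameItinerary fun p q hpq hp q' hq' => hp q' ?_
    exact fun i hi => (hpq i hi).trans (hq' i hi)
  have hVmono : Monotone V := fun m n hmn p hp q hq => hp q (hq.mono hmn)
  have hVU : ∀ n, V n ⊆ U := fun n p hp => hp p fun _ _ => Iff.rfl
  have hcover : triangleLebesgue (B ∩ U) ≤ triangleLebesgue (⋃ n, B ∩ V n) := by
    refine measure_mono_ae ?_
    filter_upwards [ae_frequently_mem_tripleCell] with p hp hpU
    obtain ⟨ε, hε, hball⟩ := Metric.isOpen_iff.1 hU p hpU.2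
    obtain ⟨n, hn⟩ := exists_forall_sameItinerary_dist_lt hp hε
    refine mem_iUnion.2 ⟨n, hpU.1, fun q hq => hball ?_⟩
    rw [Metric.mem_ball, dist_comm]
    exact hn q hq
  refine hcover.trans ?_
  rw [Monotone.measure_iUnion fun m n hmn => inter_subset_inter_right B (hVmono hmn)]
  refine iSup_le fun n => (hκ n _ (hVdet n)).trans ?_
  gcongr
  exact hVU n

lemma triangleLebesgue_univ_ne_zero : triangleLebesgue univ ≠ 0 := by
  intro h
  have := slowTriangleMeasure_absolutelyContinuous h
  rw [slowTriangleMeasure_univ] at this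
  simp at this

/-- If the complement of an invariant set has positive measure, it has a definite share of the mass
for balanced weights, where the density is bounded below by `1 / γ ^ 3 ≥ 1 / (64 αβγ)`, and hence
for all weights. -/
lemma exists_forall_weightedMass_le {B : Set closedTriangle} (hB : MeasurableSet B)
    (hinv : slowTriangleMap ⁻¹' B = B) (h0 : triangleLebesgue Bᶜ ≠ 0) :
    ∃ κ < (1 : ℝ≥0∞), ∀ α β γ, 0 < α → α ≤ β → β ≤ γ →
      weightedMass α β γ B ≤ κ * weightedMass α β γ univ := by
  set M := (triangleLebesgue univ).toReal with hM
  set a := (triangleLebesgue Bᶜ).toReal with ha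
  have hMpos : 0 < M := ENNReal.toReal_pos triangleLebesgue_univ_ne_zero (measure_ne_top _ _)
  have hapos : 0 < a := ENNReal.toReal_pos h0 (measure_ne_top _ _)
  have haM : a ≤ M := ENNReal.toReal_mono (measure_ne_top _ _) (measure_mono (subset_univ _))
  have hgood : ∀ α β γ, 0 < α → α ≤ β → β ≤ γ → γ ≤ 8 * α →
      (weightedMass α β γ B).toReal ≤ (M - a / 64) / (α * β * γ) := by
    intro α β γ hα hαβ hβγ hγα
    have hβ : 0 < β := by linarith
    have hγ : 0 < γ := by linarith
    have hadd : weightedMass α β γ B + weightedMass α β γ Bᶜ = weightedMass α β γ univ := by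
      rw [← union_compl_self B]
      exact (lintegral_union hB.compl disjoint_compl_right).symm
    have hadd' := congrArg ENNReal.toReal hadd
    rw [ENNReal.toReal_add (weightedMass_ne_top hα hβ hγ _) (weightedMass_ne_top hα hβ hγ _),
      weightedMass_univ_toReal hα hβ hγ] at hadd'
    have hlow : ENNReal.ofReal (1 / γ ^ 3) * triangleLebesgue Bᶜ ≤ weightedMass α β γ Bᶜ := by
      rw [← setLIntegral_const]
      refine lintegral_mono fun p => ENNReal.ofReal_le_ofReal ?_
      have hw := weightForm_pos hα hβ hγ p.2
      have := weightForm_le hαβ hβγ p.2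
      gcongr
    have hlow' := ENNReal.toReal_mono (weightedMass_ne_top hα hβ hγ _) hlow
    rw [ENNReal.toReal_mul, ENNReal.toReal_ofReal (by positivity)] at hlow'
    have hcmp : a / 64 / (α * β * γ) ≤ 1 / γ ^ 3 * a := by
      rw [div_div, one_div_mul_eq_div]
      refine div_le_div_of_nonneg_left hapos.le (by positivity) ?_
      calc γ ^ 3 = γ * γ * γ := by ring
        _ ≤ (8 * α) * (8 * β) * γ := by gcongr; linarith
        _ = 64 * (α * β * γ) := by ring
    rw [sub_div]
    linarith
  refine ⟨ENNReal.ofReal ((M - a / 64) / M), ?_, ?_⟩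
  · rw [ENNReal.ofReal_lt_one, div_lt_one hMpos]
    linarith
  · intro α β γ hα hαβ hβγ
    have hβ : 0 < β := by linarith
    have hγ : 0 < γ := by linarith
    have key := le_of_le_on_balanced (G := fun α β γ => (weightedMass α β γ B).toReal)
      (by linarith : M - a / 64 ≤ M) (toReal_weightedMass_le_add hB hinv.ge)
      (fun α β γ h1 h2 h3 => toReal_weightedMass_le h1 (by linarith) (by linarith) B) hgood
      α β γ hα hαβ hβγ
    rw [← ENNReal.ofReal_toReal (weightedMass_ne_top hα hβ hγ B),
      ← ENNReal.ofReal_toReal (weightedMass_ne_top hα hβ hγ univ),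
      weightedMass_univ_toReal hα hβ hγ,
      ← ENNReal.ofReal_mul (div_nonneg (by linarith) hMpos.le)]
    refine ENNReal.ofReal_le_ofReal (key.trans_eq ?_)
    rw [← hM]
    field_simp

lemma measure_eq_zero_or_compl_of_invariant {B : Set closedTriangle} (hB : MeasurableSet B)
    (hinv : slowTriangleMap ⁻¹' B = B) : triangleLebesgue B = 0 ∨ triangleLebesgue Bᶜ = 0 := by
  by_contra! h
  obtain ⟨hB0, hBc⟩ := h
  obtain ⟨κ, hκ1, hκ⟩ := exists_forall_weightedMass_le hB hinv hBc
  have hdet : ∀ n E, Determined n E → triangleLebesgue (B ∩ E) ≤ κ * triangleLebesgue E := by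
    intro n E hE
    have := weightedMass_inter_determined_le hB hinv hκ hE one_pos le_rfl le_rfl
    rwa [weightedMass_one, weightedMass_one] at this
  have hle : triangleLebesgue B ≤ κ * triangleLebesgue B := by
    refine ENNReal.le_of_forall_pos_le_add fun ε hε _ => ?_
    obtain ⟨U, hBU, hUo, hUm⟩ := B.exists_isOpen_lt_add (μ := triangleLebesgue)
      (measure_ne_top _ _) (ENNReal.coe_ne_zero.2 hε.ne')
    calc triangleLebesgue B = triangleLebesgue (B ∩ U) := by rw [inter_eq_left.2 hBU]
      _ ≤ κ * triangleLebesgue U := measure_inter_isOpen_le hdet hUo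
      _ ≤ κ * (triangleLebesgue B + ε) := by gcongr
      _ = κ * triangleLebesgue B + κ * ε := mul_add _ _ _
      _ ≤ κ * triangleLebesgue B + ε := by
        gcongr
        exact mul_le_of_le_one_left' hκ1.le
  have hlt : κ * triangleLebesgue B < 1 * triangleLebesgue B :=
    ENNReal.mul_lt_mul_left hB0 (measure_ne_top _ _) hκ1
  rw [one_mul] at hlt
  exact absurd hle (not_le.2 hlt)

lemma ergodic_slowTriangleMap : Ergodic slowTriangleMap slowTriangleMeasure := by
  refine ⟨measurePreserving_slowTriangleMap, ⟨fun B hB hinv => ?_⟩⟩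
  rw [Filter.eventuallyConst_set']
  rcases measure_eq_zero_or_compl_of_invariant hB hinv with h | h
  · exact Or.inl (ae_eq_empty.2 (slowTriangleMeasure_absolutelyContinuous h))
  · exact Or.inr (ae_eq_univ.2 (slowTriangleMeasure_absolutelyContinuous h))

/-! ### Uniqueness of the invariant measure of a conservative ergodic map -/

section Uniqueness

variable {X : Type*} [MeasurableSpace X] {μ ν ρ : Measure X} {T : X → X}

/-- A point of `s` whose image leaves `s` can never return to `s`. -/
lemma preimage_ae_eq_of_preimage_ae_le (hc : Conservative T μ) {s : Set X}
    (hs : MeasurableSet s) (h : T ⁻¹' s ≤ᵐ[μ] s) : T ⁻¹' s =ᵐ[μ] s := by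
  refine h.antisymm ?_
  have hstay : ∀ᵐ x ∂μ, ∀ n : ℕ, T (T^[n] x) ∈ s → T^[n] x ∈ s := by
    rw [ae_all_iff]
    exact fun n => (hc.toQuasiMeasurePreserving.iterate n).ae h
  filter_upwards [hstay, hc.ae_mem_imp_frequently_image_mem hs.nullMeasurableSet] with x hx hret hxs
  obtain ⟨n, hn, hns⟩ := Filter.frequently_atTop.1 (hret hxs) 1
  induction n, hn using Nat.le_induction with
  | base => exact hns
  | succ n _ ih =>
    rw [Function.iterate_succ_apply'] at hns
    exact ih (hx n hns)

/-- Sub-invariant measures of a conservative map are invariant: the sum over `n` of the defect of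
`T^[n] ⁻¹' E` telescopes to a finite number, so that almost every point for the defect enters `E`
finitely often. -/
lemma map_eq_of_measure_preimage_le (hc : Conservative T μ) [SigmaFinite ρ] (hρ : ρ ≪ μ)
    (h : ∀ E, MeasurableSet E → ρ (T ⁻¹' E) ≤ ρ E) : ρ.map T = ρ := by
  have hT := hc.measurable
  have hle : ρ.map T ≤ ρ := Measure.le_iff.2 fun E hE => by
    rw [Measure.map_apply hT hE]; exact h E hE
  have : SigmaFinite (ρ.map T) := Measure.sigmaFinite_of_le ρ hle
  set g := (ρ.map T).rnDeriv ρ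
  have hg : Measurable g := Measure.measurable_rnDeriv _ _
  set σ := ρ.withDensity (1 - g) with hσ
  have hdec : σ + ρ.map T = ρ := by
    rw [← Measure.withDensity_rnDeriv_eq (ρ.map T) ρ (Measure.absolutelyContinuous_of_le hle),
      hσ, ← withDensity_add_left (measurable_one.sub hg)]
    conv_rhs => rw [← withDensity_one (μ := ρ)]
    refine withDensity_congr_ae ?_
    filter_upwards [Measure.rnDeriv_le_one_of_le hle] with x hx
    exact tsub_add_cancel_of_le hx
  have hσρ : σ ≪ ρ := withDensity_absolutelyContinuous _ _
  have hstep : ∀ E, MeasurableSet E → σ E + ρ (T ⁻¹' E) = ρ E := fun E hE => by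
    rw [← Measure.map_apply hT hE, ← Measure.add_apply, hdec]
  have htel : ∀ E, MeasurableSet E → ∀ n : ℕ,
      ∑ k ∈ Finset.range n, σ (T^[k] ⁻¹' E) + ρ (T^[n] ⁻¹' E) = ρ E := by
    intro E hE n
    induction n with
    | zero => simp
    | succ n ih =>
      rw [Finset.sum_range_succ, Function.iterate_succ, preimage_comp, add_assoc,
        hstep _ (hT.iterate n hE), ih]
  have hfin : ∀ E, MeasurableSet E → ρ E ≠ ∞ → σ E = 0 := by
    intro E hE hρE
    have hsum : ∑' k, σ (T^[k] ⁻¹' E) ≠ ∞ := by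
      refine ne_top_of_le_ne_top hρE ?_
      rw [ENNReal.tsum_eq_iSup_nat]
      exact iSup_le fun n => le_self_add.trans (htel E hE n).le
    have hret := (hσρ.trans hρ).ae_le (hc.ae_mem_imp_frequently_image_mem hE.nullMeasurableSet)
    rw [measure_eq_zero_iff_ae_notMem]
    filter_upwards [ae_eventually_notMem hsum, hret] with x hx hx' hxE
    exact hx' hxE hx
  have hσ0 : σ = 0 := by
    rw [← Measure.measure_univ_eq_zero, ← iUnion_spanningSets ρ]
    exact measure_iUnion_null fun n =>
      hfin _ (measurableSet_spanningSets ρ n) (measure_spanningSets_lt_top ρ n).ne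
  rw [hσ0, zero_add] at hdec
  exact hdec

/-- Truncating the density of an invariant measure at the level `c` gives a sub-invariant measure,
and comparing the two measures on the sublevel set shows that the sublevel set is backward
invariant. -/
lemma preimage_sublevel_ae_le (hc : Conservative T μ) (hμ : MeasurePreserving T μ μ)
    {f : X → ℝ≥0∞} (hf : Measurable f) [SigmaFinite (μ.withDensity f)]
    (hν : MeasurePreserving T (μ.withDensity f) (μ.withDensity f)) (c : ℝ≥0∞) :
    T ⁻¹' {x | f x ≤ c} ≤ᵐ[μ] {x | f x ≤ c} := by
  set ν := μ.withDensity f with hνdef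
  set s := {x | f x ≤ c} with hs
  have hsm : MeasurableSet s := hf measurableSet_Iic
  have hT := hμ.measurable
  set ρ := μ.withDensity fun x => min (f x) c with hρdef
  have hmin : Measurable fun x => min (f x) c := hf.min measurable_const
  have hρν : ρ ≤ ν := withDensity_mono (ae_of_all _ fun x => min_le_left _ _)
  have : SigmaFinite ρ := Measure.sigmaFinite_of_le ν hρν
  have hlow : ∀ E, MeasurableSet E → E ⊆ s → ρ E = ν E := by
    intro E hE hEs
    rw [hρdef, hνdef, withDensity_apply _ hE, withDensity_apply _ hE]
    exact setLIntegral_congr_fun hE fun x hx => min_eq_left (hEs hx)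
  have hhigh : ∀ E, MeasurableSet E → E ⊆ sᶜ → ρ E = c * μ E := by
    intro E hE hEs
    rw [hρdef, withDensity_apply _ hE, ← setLIntegral_const]
    exact setLIntegral_congr_fun hE fun x hx => min_eq_right (not_le.1 (show ¬ f x ≤ c from hEs hx)).le
  have hup : ∀ E, MeasurableSet E → ρ E ≤ c * μ E := by
    intro E hE
    rw [hρdef, withDensity_apply _ hE, ← setLIntegral_const]
    exact lintegral_mono fun x => min_le_right _ _
  have hsub : ∀ E, MeasurableSet E → ρ (T ⁻¹' E) ≤ ρ E := by
    intro E hE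
    have h1 : ρ (T ⁻¹' (E ∩ s)) ≤ ρ (E ∩ s) := by
      rw [hlow _ (hE.inter hsm) inter_subset_right,
        ← hν.measure_preimage (hE.inter hsm).nullMeasurableSet]
      exact hρν _
    have h2 : ρ (T ⁻¹' (E \ s)) ≤ ρ (E \ s) := by
      rw [hhigh _ (hE.diff hsm) fun x hx => hx.2,
        ← hμ.measure_preimage (hE.diff hsm).nullMeasurableSet]
      exact hup _ (hT (hE.diff hsm))
    rw [← measure_inter_add_sdiff E hsm, ← inter_union_sdiff E s, preimage_union,
      inter_union_sdiff]
    exact (measure_union_le _ _).trans (add_le_add h1 h2)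
  have hinv := map_eq_of_measure_preimage_le hc (withDensity_absolutelyContinuous _ _) hsub
  have hpiece : ∀ n, ∀ᵐ x ∂μ, x ∈ T ⁻¹' (s ∩ spanningSets ν n) → x ∈ s := by
    intro n
    set E := s ∩ spanningSets ν n
    have hE : MeasurableSet E := hsm.inter (measurableSet_spanningSets ν n)
    have hEfin : ν E ≠ ∞ :=
      ne_top_of_le_ne_top (measure_spanningSets_lt_top ν n).ne (measure_mono inter_subset_right)
    have heq : ρ (T ⁻¹' E) = ν (T ⁻¹' E) := by
      rw [← Measure.map_apply hT hE, hinv, hlow E hE inter_subset_left,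
        hν.measure_preimage hE.nullMeasurableSet]
    have hρfin : ρ (T ⁻¹' E) ≠ ∞ := by
      rwa [heq, hν.measure_preimage hE.nullMeasurableSet]
    rw [hρdef, hνdef, withDensity_apply _ (hT hE), withDensity_apply _ (hT hE)] at heq
    rw [hρdef, withDensity_apply _ (hT hE)] at hρfin
    have := ae_eq_of_ae_le_of_lintegral_le (ae_of_all _ fun x => min_le_left (f x) c) hρfin
      hf.aemeasurable heq.ge
    rw [Filter.EventuallyEq, ae_restrict_iff' (hT hE)] at this
    filter_upwards [this] with x hx hxE
    exact min_eq_left_iff.1 (hx hxE)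
  filter_upwards [ae_all_iff.2 hpiece] with x hx hxs
  obtain ⟨n, hn⟩ := mem_iUnion.1 ((iUnion_spanningSets ν).symm ▸ mem_univ (T x))
  exact hx n ⟨hxs, hn⟩

lemma exists_eq_smul_of_sigmaFinite (hc : Conservative T μ) (he : Ergodic T μ) [SigmaFinite μ]
    [SigmaFinite ν] (hνμ : ν ≪ μ) (hν : MeasurePreserving T ν ν) :
    ∃ c : ℝ≥0∞, ν = c • μ := by
  set f := ν.rnDeriv μ
  have hf : Measurable f := Measure.measurable_rnDeriv _ _
  have hνf : μ.withDensity f = ν := Measure.withDensity_rnDeriv_eq ν μ hνμ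
  have : SigmaFinite (μ.withDensity f) := by rwa [hνf]
  have hlevel : ∀ c : ℝ≥0∞, (∀ᵐ x ∂μ, ¬ f x ≤ c) ∨ ∀ᵐ x ∂μ, f x ≤ c := by
    intro c
    have hsm : MeasurableSet {x | f x ≤ c} := hf measurableSet_Iic
    have := preimage_ae_eq_of_preimage_ae_le hc hsm
      (preimage_sublevel_ae_le hc he.toMeasurePreserving hf (by rwa [hνf]) c)
    rcases he.quasiErgodic.ae_empty_or_univ₀ hsm.nullMeasurableSet this with h | h
    · exact Or.inl (measure_eq_zero_iff_ae_notMem.1 (ae_eq_empty.1 h))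
    · exact Or.inr (Filter.eventuallyEq_univ.1 h)
  -- Each sublevel set is null or conull; at a level below the essential supremum it is null.
  refine ⟨essSup f μ, ?_⟩
  have hconst : f =ᵐ[μ] fun _ => essSup f μ := by
    have hle : f ≤ᵐ[μ] fun _ => essSup f μ := ENNReal.ae_le_essSup f
    refine hle.antisymm ?_
    rcases eq_or_ne (essSup f μ) 0 with h0 | h0
    · exact ae_of_all _ fun x => by simp [h0]
    · obtain ⟨u, -, hu, hlim⟩ := exists_seq_strictMono_tendsto' (pos_iff_ne_zero.2 h0)
      have : ∀ᵐ x ∂μ, ∀ n, ¬ f x ≤ u n := by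
        rw [ae_all_iff]
        intro n
        refine (hlevel (u n)).resolve_right fun h => ?_
        exact absurd (essSup_le_of_ae_le _ h) (not_le.2 (hu n).2)
      filter_upwards [this] with x hx
      exact le_of_tendsto' hlim fun n => (not_le.1 (hx n)).le
  rw [← hνf, withDensity_congr_ae hconst, withDensity_const]

/-- An invariant measure `ν ≪ μ` without any finiteness assumption is either σ-finite or infinite on
every set of positive `μ`-measure: the largest set on which `ν` is σ-finite is backward
invariant. -/
lemma exists_eq_smul (hc : Conservative T μ) (he : Ergodic T μ) [SigmaFinite μ]
    (hνμ : ν ≪ μ) (hν : MeasurePreserving T ν ν) :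
    ∃ c : ℝ≥0∞, ν = c • μ := by
  set A := ν.sigmaFiniteSetWRT μ with hA
  have hAm : MeasurableSet A := measurableSet_sigmaFiniteSetWRT
  have hle : T ⁻¹' A ≤ᵐ[μ] A := by
    have hpiece : ∀ n, ∀ᵐ x ∂μ,
        x ∉ T ⁻¹' (spanningSets (ν.restrict A) n ∩ A) \ A := by
      intro n
      rw [← measure_eq_zero_iff_ae_notMem]
      by_contra h0
      have htop := measure_eq_top_of_subset_compl_sigmaFiniteSetWRT
        (μ := ν) (ν := μ) (fun x hx => hx.2) h0
      have hm : MeasurableSet (spanningSets (ν.restrict A) n ∩ A) :=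
        (measurableSet_spanningSets _ n).inter hAm
      have hfin := measure_spanningSets_lt_top (ν.restrict A) n
      rw [Measure.restrict_apply (measurableSet_spanningSets _ n),
        ← hν.measure_preimage hm.nullMeasurableSet] at hfin
      exact (measure_mono sdiff_subset).trans_lt hfin |>.ne htop
    filter_upwards [ae_all_iff.2 hpiece] with x hx hxA
    by_contra hxA'
    obtain ⟨n, hn⟩ := mem_iUnion.1 ((iUnion_spanningSets (ν.restrict A)).symm ▸ mem_univ (T x))
    exact hx n ⟨⟨hn, hxA⟩, hxA'⟩
  rcases he.quasiErgodic.ae_empty_or_univ₀ hAm.nullMeasurableSet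
    (preimage_ae_eq_of_preimage_ae_le hc hAm hle) with h | h
  · refine ⟨∞, ?_⟩
    have hcompl : (Aᶜ : Set X) =ᵐ[μ] univ :=
      ae_eq_univ.2 (by rw [compl_compl]; exact ae_eq_empty.1 h)
    have hμ : μ.restrict Aᶜ = μ := by
      rw [Measure.restrict_congr_set hcompl, Measure.restrict_univ]
    have hν' : ν.restrict Aᶜ = ν := by
      rw [Measure.restrict_congr_set (hνμ.ae_eq hcompl), Measure.restrict_univ]
    calc ν = ν.restrict Aᶜ := hν'.symm
      _ = ∞ • μ.restrict Aᶜ := restrict_compl_sigmaFiniteSetWRT hνμ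
      _ = ∞ • μ := by rw [hμ]
  · have hfin : SigmaFinite (ν.restrict A) := inferInstance
    rw [Measure.restrict_congr_set (hνμ.ae_eq h), Measure.restrict_univ] at hfin
    exact exists_eq_smul_of_sigmaFinite hc he hνμ hν

end Uniqueness

lemma not_sigmaFinite_top_smul {X : Type*} [MeasurableSpace X] {μ : Measure X} (hμ : μ ≠ 0) :
    ¬ SigmaFinite ((∞ : ℝ≥0∞) • μ) := by
  intro h
  apply hμ
  rw [← Measure.measure_univ_eq_zero, ← iUnion_spanningSets ((∞ : ℝ≥0∞) • μ)]
  refine measure_iUnion_null fun n => ?_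
  by_contra h0
  have := measure_spanningSets_lt_top ((∞ : ℝ≥0∞) • μ) n
  rw [Measure.smul_apply, smul_eq_mul, ENNReal.top_mul h0] at this
  exact lt_irrefl _ this

theorem mainTheorem2 :
    Conservative slowTriangleMap slowTriangleMeasure ∧
    Ergodic slowTriangleMap slowTriangleMeasure ∧
    slowTriangleMeasure ≪ triangleLebesgue ∧
    (∀ ν : Measure closedTriangle, ν ≪ triangleLebesgue →
      Ergodic slowTriangleMap ν →
        ∃ c : ℝ≥0∞, ν = c • slowTriangleMeasure ∧ (SigmaFinite ν → c ≠ ∞)) ∧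
    SigmaFinite slowTriangleMeasure ∧
    slowTriangleMeasure univ = ∞ := by
  refine ⟨conservative_slowTriangleMap, ergodic_slowTriangleMap,
    slowTriangleMeasure_absolutelyContinuous, fun ν hν hνe => ?_, inferInstance,
    slowTriangleMeasure_univ⟩
  obtain ⟨c, hc⟩ := exists_eq_smul conservative_slowTriangleMap ergodic_slowTriangleMap
    (hν.trans triangleLebesgue_absolutelyContinuous) hνe.toMeasurePreserving
  refine ⟨c, hc, ?_⟩
  rintro hfin rfl
  refine not_sigmaFinite_top_smul (fun h => ?_) (hc ▸ hfin)
  simpa [h] using slowTriangleMeasure_univ
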